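/- Let $1\le k\le n$ and $J=[n]\sqcup[n]^*$ with its involution $a\mapsto a^*$. Call $A\subseteq J$ admissible if $A\cap A^*=\emptyset$, and let $U^*_{k,n}$ be the family of all admissible subsets of $J$ of size $k$. For a matroid $M$ on $J$, let $I^{ad}(M)$ be the family of independent sets of $M$ whose closure is admissible. A loopless matroid $M$ on $J$ is called admissible if for every $A\subseteq J$ $$r_M(A)=\max_{I}\begin{cases}|I|+2 & \text{if there is } \{a,a^*\}\subseteq A \text{ with } I\cup\{a\},\,I\cup\{a^*\}\in I^{ad}(M),\\ |I| & \text{otherwise,}\end{cases}$$ where $I$ runs over the admissible independent sets of $M$ contained in $A$. The enveloping matroid of a family $\mathcal S$ of subsets of $J$ is the admissible matroid whose family of admissible bases is $\mathcal S$ and whose dependent sets are dependent in every other admissible matroid whose family of admissible bases is $\mathcal S$. If $\mathcal S$ has the enveloping matroid $M$, let $L(\mathcal S)$ consist of the admissible flats of $M$ and of $J$. The Bergman fan $B(\mathcal S)$ is the collection of the cones in $\mathbb R^n$ spanned with nonnegative coefficients by the vectors $e_F^{\pm}$, $F\in\mathcal F$, where $\mathcal F$ runs over the (possibly empty) chains in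 $L(\mathcal S)\setminus\{\emptyset,J\}$ and $e^{\pm}_F=\sum_{i\in F\cap[n]}e_i-\sum_{i^*\in F\cap[n]^*}e_i$. A Minkowski weight of dimension $d$ on a finite fan $\Sigma$ in $\mathbb R^n$ is a function $c:\Sigma_d\to\mathbb Z$ on its $d$-dimensional cones such that, for every $(d-1)$-dimensional cone $\tau\in\Sigma$, the sum $\sum_{\tau\subset\sigma\in\Sigma_d}c(\sigma)\,e_{\sigma/\tau}$ lies in the linear span of $\tau$, for any representatives $e_{\sigma/\tau}\in\sigma$ of generators of $N_\sigma/N_\tau$, where $N_\sigma=\mathbb Z^n\cap\operatorname{span}\sigma$; these form a group $MW_d(\Sigma)$. Then $U^*_{k,n}$ has a unique enveloping matroid, and $$MW_{k-1}(B(U^*_{k,n}))\cong\mathbb Z^{\binom{n}{k-1}}.$$ In particular, for $k\ge 2$ this group is not isomorphic to $\mathbb Z$. -/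

import Mathlib

open Module

namespace SympMatroid

/-! ### The ground set `J = [n] ⊔ [n]*` -/

/-- The ground set `J = [n] ⊔ [n]*`: `Sum.inl i` is `i` and `Sum.inr i` is `i*`. -/
abbrev Ground (n : ℕ) : Type := Fin n ⊕ Fin n

/-- The involution `a ↦ a*` of `J`. -/
def star {n : ℕ} (a : Ground n) : Ground n := a.swap

/-- `A ⊆ J` is admissible if `A ∩ A* = ∅`. -/
def Admissible {n : ℕ} (A : Set (Ground n)) : Prop := A ∩ star '' A = ∅

/-! ### Admissible matroids, ranked symplectic matroids, lattices of flats -/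

/-- The family `I^ad(M)` of independent sets of `M` with admissible closure. -/
def admIndep {n : ℕ} (M : Matroid (Ground n)) : Set (Set (Ground n)) :=
  {I | M.Indep I ∧ Admissible (M.closure I)}

open Classical in
/-- The quantity maximized over `I` in the rank formula of an admissible matroid: `|I| + 2` if
some pair `{a, a*} ⊆ A` has `I ∪ {a}, I ∪ {a*} ∈ I^ad(M)`, and `|I|` otherwise. -/
noncomputable def rankValue {n : ℕ} (M : Matroid (Ground n)) (A I : Set (Ground n)) : ℕ∞ :=
  if ∃ a, a ∈ A ∧ star a ∈ A ∧ insert a I ∈ admIndep M ∧ insert (star a) I ∈ admIndep M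
  then I.encard + 2 else I.encard

/-- A loopless matroid on `J` is admissible if the rank of every `A ⊆ J` is the maximum of
`rankValue M A I` over the admissible independent sets `I ⊆ A`. -/
structure IsAdmissibleMatroid {n : ℕ} (M : Matroid (Ground n)) : Prop where
  ground_eq : M.E = Set.univ
  loopless : M.Loopless
  rank_eq : ∀ A : Set (Ground n),
    IsGreatest {r : ℕ∞ | ∃ I ⊆ A, M.Indep I ∧ Admissible I ∧ r = rankValue M A I} (M.eRk A)

/-- The family of admissible bases of a matroid on `J`. -/
def admissibleBases {n : ℕ} (M : Matroid (Ground n)) : Set (Set (Ground n)) :=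
  {B | M.IsBase B ∧ Admissible B}

/-- `M` is the (minimal) enveloping matroid of `S`: it is an admissible matroid with family of
admissible bases `S`, and among all these it has the smallest family of dependent sets. -/
structure IsEnvelopingMatroid {n : ℕ} (S : Set (Set (Ground n))) (M : Matroid (Ground n)) :
    Prop where
  admissible : IsAdmissibleMatroid M
  bases_eq : admissibleBases M = S
  minimal : ∀ M' : Matroid (Ground n), IsAdmissibleMatroid M' → admissibleBases M' = S →
    ∀ X : Set (Ground n), M.Dep X → M'.Dep X

/-- The uniform symplectic matroid `U*_{k,n}`: all admissible sets of size `k`. -/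
def uniform (k n : ℕ) : Set (Set (Ground n)) := {B | Admissible B ∧ B.ncard = k}

/-- The lattice of flats of the ranked symplectic matroid with enveloping matroid `M`: the
admissible flats of `M`, together with `J`. -/
def latticeOfFlats {n : ℕ} (M : Matroid (Ground n)) : Set (Set (Ground n)) :=
  {F | M.IsFlat F ∧ Admissible F} ∪ {Set.univ}

/-! ### The Bergman fan -/

/-- The vectors `e_i^± = e_i` and `e_{i*}^± = -e_i` of `ℝⁿ`. -/
noncomputable def signedUnit {n : ℕ} : Ground n → (Fin n → ℝ)
  | Sum.inl i => Pi.single i 1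
  | Sum.inr i => -Pi.single i 1

open Classical in
/-- The vector `e_F^± = ∑_{a ∈ F} e_a^±` of `ℝⁿ`. -/
noncomputable def signedVec {n : ℕ} (F : Set (Ground n)) : Fin n → ℝ :=
  ∑ a with a ∈ F, signedUnit a

/-- The cone in `ℝⁿ` spanned with nonnegative coefficients by the `e_F^±`, `F ∈ C`. -/
noncomputable def flagCone {n : ℕ} (C : Set (Set (Ground n))) : PointedCone ℝ (Fin n → ℝ) :=
  PointedCone.hull ℝ (signedVec '' C)

/-- The Bergman fan: the cones spanned by the chains (the empty one included) of
`L(S) \ {∅, J}`, where `S` is the ranked symplectic matroid with enveloping matroid `M`. -/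
def bergmanFan {n : ℕ} (M : Matroid (Ground n)) : Set (PointedCone ℝ (Fin n → ℝ)) :=
  {σ | ∃ C : Set (Set (Ground n)),
    C ⊆ latticeOfFlats M \ {∅, Set.univ} ∧ IsChain (· ⊆ ·) C ∧ σ = flagCone C}

instance bergmanFan_finite {n : ℕ} (M : Matroid (Ground n)) : Finite (bergmanFan M) := by
  refine Set.Finite.to_subtype ((Set.finite_range (flagCone (n := n))).subset ?_)
  rintro σ ⟨C, -, -, rfl⟩
  exact ⟨C, rfl⟩

/-! ### Minkowski weights on a finite fan in `ℝⁿ` with lattice `ℤⁿ` -/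

/-- The dimension of a cone: the dimension of its linear span. -/
noncomputable def coneDim {n : ℕ} (σ : PointedCone ℝ (Fin n → ℝ)) : ℕ :=
  finrank ℝ (Submodule.span ℝ (σ : Set (Fin n → ℝ)))

/-- The `d`-dimensional cones of a collection of cones. -/
def conesOfDim {n : ℕ} (Δ : Set (PointedCone ℝ (Fin n → ℝ))) (d : ℕ) :
    Set (PointedCone ℝ (Fin n → ℝ)) :=
  {σ | σ ∈ Δ ∧ coneDim σ = d}

/-- The lattice `ℤⁿ` in `ℝⁿ`. -/
def integerLattice (n : ℕ) : AddSubgroup (Fin n → ℝ) :=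
  ((Int.castAddHom ℝ).compLeft (Fin n)).range

/-- `N_σ`: the lattice points in the linear span of `σ`. -/
def coneLattice {n : ℕ} (σ : PointedCone ℝ (Fin n → ℝ)) : AddSubgroup (Fin n → ℝ) :=
  integerLattice n ⊓ (Submodule.span ℝ (σ : Set (Fin n → ℝ))).toAddSubgroup

/-- `u` is a representative in `σ` of a generator of `N_σ / N_τ`. -/
def IsNormalVector {n : ℕ} (τ σ : PointedCone ℝ (Fin n → ℝ)) (u : Fin n → ℝ) : Prop :=
  u ∈ σ ∧ coneLattice σ = coneLattice τ ⊔ AddSubgroup.zmultiples u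

/-- The balancing condition for a weight `c` of dimension `d`: for every `(d-1)`-dimensional cone
`τ` and all choices of representatives `e_{σ/τ} ∈ σ`, the sum of `c(σ) e_{σ/τ}` over the
`d`-dimensional cones `σ ⊇ τ` lies in the linear span of `τ`. -/
def IsBalanced {n : ℕ} (Δ : Set (PointedCone ℝ (Fin n → ℝ))) (d : ℕ)
    (c : conesOfDim Δ d → ℤ) : Prop :=
  ∀ τ ∈ Δ, coneDim τ + 1 = d →
    ∀ u : conesOfDim Δ d → (Fin n → ℝ),
      (∀ σ : conesOfDim Δ d, τ ≤ σ.1 → IsNormalVector τ σ.1 (u σ)) →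
      ∑ᶠ (σ : conesOfDim Δ d) (_ : τ ≤ σ.1), c σ • u σ ∈
        Submodule.span ℝ (τ : Set (Fin n → ℝ))

/-- The group `MW_d(Δ)` of Minkowski weights of dimension `d` on a finite fan `Δ`, as a subgroup
of the group of all integer weights on the `d`-dimensional cones. -/
def minkowskiWeights {n : ℕ} (Δ : Set (PointedCone ℝ (Fin n → ℝ))) [Finite Δ] (d : ℕ) :
    AddSubgroup (conesOfDim Δ d → ℤ) where
  carrier := {c | IsBalanced Δ d c}
  zero_mem' := by
    intro τ _ _ u _
    simp
  add_mem' := by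
    intro c c' hc hc' τ hτ hd u hu
    have hfin : Finite (conesOfDim Δ d) :=
      ((Set.toFinite Δ).subset fun _ h => h.1).to_subtype
    have h := Submodule.add_mem _ (hc τ hτ hd u hu) (hc' τ hτ hd u hu)
    rw [← finsum_add_distrib (Set.toFinite _) (Set.toFinite _)] at h
    convert h using 3 with σ
    by_cases hσ : τ ≤ σ.1 <;> simp [hσ, add_smul]
  neg_mem' := by
    intro c hc τ hτ hd u hu
    have h := Submodule.neg_mem _ (hc τ hτ hd u hu)
    simpa only [← finsum_neg_distrib, Pi.neg_apply, neg_smul] using h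

end SympMatroid

/-!
The matroid on `J` whose independent sets are the sets of at most `k` elements that contain at most
one pair `{a, a*}` is admissible, and its admissible bases are the members of `U*_{k,n}`. By the
rank formula, an independent set of any admissible matroid contains at most one such pair, so this
matroid has the fewest dependent sets.

The cones of its Bergman fan are indexed by the flags of admissible sets with at most `d = k - 1`
elements. A flag with `d - 1` members is completed by the sets of one size `j`. If `j < d`, these
are two sets `L ∪ {a}` and `L ∪ {b}` between consecutive members `L` and `L ∪ {a, b}` (with `L = ∅`
if `j = 1`); if `j = d`, they are the sets `L ∪ {a}`, paired by exchanging `a` and `a*`. In both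
cases the vectors of a pair are opposite modulo the span of the flag and there are no other
relations, so balancing says that a weight takes the same value on the two members of each pair.
Exchanging neighbours in the order in which a complete flag grows, and starring the last element
added, connects all complete flags whose top sets have the same indices. Hence a Minkowski weight
is an arbitrary function of the `d`-element subset of `[n]` on which the cone is supported.
-/

namespace SympMatroid

variable {n : ℕ}

/-! ### Admissible sets -/

/-- The element of `[n]` underlying an element of `J`. -/
def index : Ground n → Fin n := Sum.elim id id

@[simp] lemma index_inl (i : Fin n) : index (Sum.inl i : Ground n) = i := rfl

@[simp] lemma index_inr (i : Fin n) : index (Sum.inr i : Ground n) = i := rfl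

@[simp] lemma index_star (a : Ground n) : index (star a) = index a := by
  cases a <;> rfl

@[simp] lemma star_star (a : Ground n) : star (star a) = a := Sum.swap_swap a

lemma star_ne_self (a : Ground n) : star a ≠ a := by
  cases a <;> simp [star]

lemma index_eq_index_iff {a b : Ground n} : index a = index b ↔ b = a ∨ b = star a := by
  cases a <;> cases b <;> simp [star, eq_comm]

lemma admissible_iff {A : Set (Ground n)} : Admissible A ↔ ∀ a ∈ A, star a ∉ A := by
  simp only [Admissible, Set.eq_empty_iff_forall_notMem, Set.mem_inter_iff, Set.mem_image, not_and]
  constructor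
  · intro h a ha hs
    exact h _ hs ⟨a, ha, rfl⟩
  · rintro h _ ha ⟨b, hb, rfl⟩
    exact h b hb ha

lemma admissible_iff_injOn {A : Set (Ground n)} : Admissible A ↔ Set.InjOn index A := by
  rw [admissible_iff]
  constructor
  · intro h a ha b hb hab
    exact ((index_eq_index_iff.1 hab).resolve_right fun hs => h a ha (hs ▸ hb)).symm
  · intro h a ha hs
    exact star_ne_self a (h hs ha (index_star a))

lemma admissible_empty : Admissible (∅ : Set (Ground n)) := Set.empty_inter _

lemma not_admissible_univ (hn : 1 ≤ n) : ¬ Admissible (Set.univ : Set (Ground n)) :=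
  fun h => admissible_iff.1 h (Sum.inl ⟨0, hn⟩) trivial trivial

namespace Admissible

lemma subset {A B : Set (Ground n)} (hB : Admissible B) (h : A ⊆ B) : Admissible A :=
  admissible_iff_injOn.2 ((admissible_iff_injOn.1 hB).mono h)

lemma ncard_index {A : Set (Ground n)} (h : Admissible A) : (index '' A).ncard = A.ncard :=
  (admissible_iff_injOn.1 h).ncard_image

lemma star_notMem_of_insert {a : Ground n} {A : Set (Ground n)} (h : Admissible (insert a A)) :
    star a ∉ A :=
  fun hs => admissible_iff.1 h a (Set.mem_insert a A) (Set.mem_insert_of_mem a hs)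

lemma insert_star {a : Ground n} {A : Set (Ground n)} (h : Admissible (insert a A)) (ha : a ∉ A) :
    Admissible (insert (star a) A) := by
  rw [admissible_iff_injOn, Set.injOn_insert h.star_notMem_of_insert, index_star]
  rw [admissible_iff_injOn, Set.injOn_insert ha] at h
  exact h

end Admissible

lemma exists_admissible_ncard {k : ℕ} (hkn : k ≤ n) :
    ∃ A : Set (Ground n), Admissible A ∧ A.ncard = k := by
  obtain ⟨s, -, hs⟩ := Set.exists_subset_card_eq (s := (Set.univ : Set (Fin n))) (n := k)
    (by rwa [Set.ncard_univ, Nat.card_fin])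
  refine ⟨Sum.inl '' s, ?_, by rw [Set.ncard_image_of_injective s Sum.inl_injective, hs]⟩
  exact admissible_iff_injOn.2 (Set.InjOn.image_of_comp fun i _ j _ hij => hij)

/-! ### The enveloping matroid of the uniform symplectic matroid -/

/-- `A` contains at most one pair `{a, a*}`. -/
def AlmostAdmissible (A : Set (Ground n)) : Prop := A.ncard ≤ (index '' A).ncard + 1

lemma Admissible.almostAdmissible {A : Set (Ground n)} (h : Admissible A) : AlmostAdmissible A :=
  h.ncard_index.ge.trans (Nat.le_succ _)

lemma Admissible.almostAdmissible_insert {A : Set (Ground n)} (h : Admissible A) (a : Ground n) :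
    AlmostAdmissible (insert a A) :=
  calc (insert a A).ncard ≤ A.ncard + 1 := Set.ncard_insert_le a A
    _ = (index '' A).ncard + 1 := by rw [h.ncard_index]
    _ ≤ (index '' insert a A).ncard + 1 := by
      gcongr
      exacts [Set.toFinite _, Set.subset_insert a A]

lemma AlmostAdmissible.subset {A B : Set (Ground n)} (hB : AlmostAdmissible B) (h : A ⊆ B) :
    AlmostAdmissible A := by
  have hcard := Set.ncard_sdiff_add_ncard_of_subset h
  have hindex : (index '' B).ncard ≤ (index '' A).ncard + (B \ A).ncard :=
    calc (index '' B).ncard = (index '' A ∪ index '' (B \ A)).ncard := by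
          rw [← Set.image_union, Set.union_sdiff_cancel h]
      _ ≤ (index '' A).ncard + (index '' (B \ A)).ncard := Set.ncard_union_le _ _
      _ ≤ _ := by gcongr; exact Set.ncard_image_le
  unfold AlmostAdmissible at *
  omega

lemma AlmostAdmissible.exists_insert {A B : Set (Ground n)} (hA : AlmostAdmissible A)
    (hB : AlmostAdmissible B) (h : A.ncard < B.ncard) :
    ∃ b ∈ B, b ∉ A ∧ AlmostAdmissible (insert b A) := by
  unfold AlmostAdmissible at *
  by_cases hlt : (index '' A).ncard < (index '' B).ncard
  · obtain ⟨_, ⟨b, hb, rfl⟩, hbA⟩ := Set.exists_mem_notMem_of_ncard_lt_ncard hlt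
    refine ⟨b, hb, fun h => hbA ⟨b, h, rfl⟩, ?_⟩
    rw [Set.image_insert_eq, Set.ncard_insert_of_notMem hbA]
    exact (Set.ncard_insert_le b A).trans (by omega)
  · obtain ⟨b, hb, hbA⟩ := Set.exists_mem_notMem_of_ncard_lt_ncard h
    have hle : (index '' A).ncard ≤ (index '' insert b A).ncard :=
      Set.ncard_le_ncard (Set.image_mono (Set.subset_insert b A))
    exact ⟨b, hb, hbA, (Set.ncard_insert_le b A).trans (by omega)⟩

/-- The matroid on `J` whose independent sets have at most `k` elements and contain at most one
pair `{a, a*}`: the enveloping matroid of `U*_{k,n}`. -/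
def uniformEnvelope (k n : ℕ) : Matroid (Ground n) :=
  (IndepMatroid.ofFinite (E := Set.univ) Set.finite_univ
    (fun X => X.ncard ≤ k ∧ AlmostAdmissible X)
    ⟨by simp, admissible_empty.almostAdmissible⟩
    (fun _ _ hJ hIJ => ⟨(Set.ncard_le_ncard hIJ).trans hJ.1, hJ.2.subset hIJ⟩)
    (by
      intro I J hI hJ hIJ
      obtain ⟨e, he, heI, h⟩ := hI.2.exists_insert hJ.2 hIJ
      exact ⟨e, he, heI, (Set.ncard_insert_le e I).trans (hIJ.trans_le hJ.1), h⟩)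
    (fun _ _ => Set.subset_univ _)).matroid

section Envelope

variable {k : ℕ} {A I X : Set (Ground n)} {a : Ground n} {M : Matroid (Ground n)}

lemma uniformEnvelope_ground : (uniformEnvelope k n).E = Set.univ := rfl

lemma uniformEnvelope_indep_iff :
    (uniformEnvelope k n).Indep X ↔ X.ncard ≤ k ∧ AlmostAdmissible X := Iff.rfl

lemma Admissible.indep_uniformEnvelope (h : Admissible X) (hX : X.ncard ≤ k) :
    (uniformEnvelope k n).Indep X :=
  uniformEnvelope_indep_iff.2 ⟨hX, h.almostAdmissible⟩

lemma isBase_uniformEnvelope_of_ncard_eq (h : (uniformEnvelope k n).Indep X) (hX : X.ncard = k) :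
    (uniformEnvelope k n).IsBase X :=
  Matroid.isBase_iff_maximal_indep.2 ⟨h, fun _ hY hXY =>
    (Set.eq_of_subset_of_ncard_le hXY (hX ▸ (uniformEnvelope_indep_iff.1 hY).1)).ge⟩

lemma admissibleBases_uniformEnvelope (hkn : k ≤ n) :
    admissibleBases (uniformEnvelope k n) = uniform k n := by
  obtain ⟨A, hA, hAk⟩ := exists_admissible_ncard hkn
  have hAbase := isBase_uniformEnvelope_of_ncard_eq (hA.indep_uniformEnvelope hAk.le) hAk
  ext B
  constructor
  · rintro ⟨hB, hadm⟩
    exact ⟨hadm, (hB.ncard_eq_ncard_of_isBase hAbase).trans hAk⟩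
  · rintro ⟨hadm, hB⟩
    exact ⟨isBase_uniformEnvelope_of_ncard_eq (hadm.indep_uniformEnvelope hB.le) hB, hadm⟩

lemma Admissible.closure_uniformEnvelope (h : Admissible X) (hX : X.ncard < k) :
    (uniformEnvelope k n).closure X = X := by
  refine subset_antisymm (fun e he => ?_) (Matroid.subset_closure _ _ (Set.subset_univ _))
  by_contra heX
  rw [(h.indep_uniformEnvelope hX.le).mem_closure_iff_of_notMem heX] at he
  exact he.not_indep ⟨(Set.ncard_insert_le e X).trans hX, h.almostAdmissible_insert e⟩

lemma ncard_lt_of_admissible_closure (hn : 1 ≤ n)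
    (h : Admissible ((uniformEnvelope k n).closure X)) : X.ncard < k := by
  by_contra! hX
  obtain ⟨Y, hYX, hY⟩ := Set.exists_subset_card_eq hX
  have hadm : Admissible Y := h.subset (hYX.trans (Matroid.subset_closure _ _ (Set.subset_univ _)))
  have hbase := isBase_uniformEnvelope_of_ncard_eq (hadm.indep_uniformEnvelope hY.le) hY
  refine not_admissible_univ hn (h.subset ?_)
  rw [← uniformEnvelope_ground (k := k), ← hbase.closure_eq]
  exact Matroid.closure_subset_closure _ hYX

lemma isFlat_uniformEnvelope_and_admissible_iff (hn : 1 ≤ n) :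
    ((uniformEnvelope k n).IsFlat X ∧ Admissible X) ↔ Admissible X ∧ X.ncard < k := by
  rw [Matroid.isFlat_iff_closure_eq]
  constructor
  · rintro ⟨hflat, h⟩
    exact ⟨h, ncard_lt_of_admissible_closure hn (by rwa [hflat])⟩
  · rintro ⟨h, hX⟩
    exact ⟨h.closure_uniformEnvelope hX, h⟩

lemma admissible_of_mem_admIndep (h : I ∈ admIndep M) : Admissible I :=
  h.2.subset (M.subset_closure I h.1.subset_ground)

lemma mem_admIndep_uniformEnvelope_iff (hn : 1 ≤ n) :
    X ∈ admIndep (uniformEnvelope k n) ↔ Admissible X ∧ X.ncard < k := by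
  constructor
  · exact fun h => ⟨admissible_of_mem_admIndep h, ncard_lt_of_admissible_closure hn h.2⟩
  · rintro ⟨h, hX⟩
    exact ⟨h.indep_uniformEnvelope hX.le, by rwa [h.closure_uniformEnvelope hX]⟩

lemma notMem_of_insert_star_mem_admIndep (h : insert (star a) I ∈ admIndep M) : a ∉ I := by
  simpa only [star_star] using (admissible_of_mem_admIndep h).star_notMem_of_insert

lemma encard_le_rankValue (M : Matroid (Ground n)) (A I : Set (Ground n)) :
    I.encard ≤ rankValue M A I := by
  unfold rankValue
  split_ifs
  · exact le_self_add
  · exact le_rfl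

lemma rankValue_uniformEnvelope_le_eRk (hn : 1 ≤ n) (hIA : I ⊆ A)
    (hI : (uniformEnvelope k n).Indep I) :
    rankValue (uniformEnvelope k n) A I ≤ (uniformEnvelope k n).eRk A := by
  unfold rankValue
  split_ifs with h
  · obtain ⟨a, ha, hsA, h1, h2⟩ := h
    have haI : a ∉ I := notMem_of_insert_star_mem_admIndep h2
    obtain ⟨hadm, hlt⟩ := (mem_admIndep_uniformEnvelope_iff hn).1 h1
    have hsI : star a ∉ insert a I := fun hs =>
      hs.elim (star_ne_self a) hadm.star_notMem_of_insert
    have hind : (uniformEnvelope k n).Indep (insert (star a) (insert a I)) :=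
      ⟨(Set.ncard_insert_le _ _).trans hlt, hadm.almostAdmissible_insert _⟩
    calc I.encard + 2 = (insert (star a) (insert a I)).encard := by
          rw [Set.encard_insert_of_notMem hsI, Set.encard_insert_of_notMem haI, add_assoc]
          rfl
      _ ≤ _ := hind.encard_le_eRk_of_subset (Set.insert_subset hsA (Set.insert_subset ha hIA))
  · exact hI.encard_le_eRk_of_subset hIA

lemma rankValue_uniformEnvelope_sdiff_singleton (hn : 1 ≤ n) {T : Set (Ground n)}
    (hT : Admissible T) (hTA : T ⊆ A) (hTk : T.ncard < k) (ha : a ∈ T) (hs : star a ∈ A) :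
    rankValue (uniformEnvelope k n) A (T \ {a}) = (T \ {a}).encard + 2 := by
  have hinsert : insert a (T \ {a}) = T := by
    rw [Set.insert_sdiff_singleton, Set.insert_eq_of_mem ha]
  have hcard : (insert (star a) (T \ {a})).ncard < k :=
    (Set.ncard_insert_le _ _).trans_lt (by rwa [Set.ncard_sdiff_singleton_add_one ha])
  refine if_pos ⟨a, hTA ha, hs, (mem_admIndep_uniformEnvelope_iff hn).2 ?_,
    (mem_admIndep_uniformEnvelope_iff hn).2 ⟨?_, hcard⟩⟩
  · rw [hinsert]
    exact ⟨hT, hTk⟩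
  · exact Admissible.insert_star (by rwa [hinsert]) fun h => h.2 rfl

lemma exists_eRk_le_rankValue_uniformEnvelope (hn : 1 ≤ n) (A : Set (Ground n)) :
    ∃ I ⊆ A, (uniformEnvelope k n).Indep I ∧ Admissible I ∧
      (uniformEnvelope k n).eRk A ≤ rankValue (uniformEnvelope k n) A I := by
  obtain ⟨T, hTA, hT⟩ := Set.exists_subset_bijOn A index
  have hTadm : Admissible T := admissible_iff_injOn.2 hT.injOn
  obtain ⟨B, hB⟩ := (uniformEnvelope k n).exists_isBasis A (Set.subset_univ _)
  obtain ⟨hBk, hBindex⟩ := uniformEnvelope_indep_iff.1 hB.indep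
  rw [hB.eRk_eq_encard, ← (Set.toFinite B).cast_ncard_eq]
  by_cases hBT : B.ncard ≤ T.ncard
  · obtain ⟨I, hIT, hI⟩ := Set.exists_subset_card_eq hBT
    refine ⟨I, hIT.trans hTA, (hTadm.subset hIT).indep_uniformEnvelope (hI.trans_le hBk),
      hTadm.subset hIT, ?_⟩
    rw [← hI, (Set.toFinite I).cast_ncard_eq]
    exact encard_le_rankValue _ _ _
  · have hBA := Set.ncard_le_ncard hB.subset
    have hBT' : B.ncard ≤ T.ncard + 1 := by
      rw [← hTadm.ncard_index, hT.image_eq]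
      exact hBindex.trans (by gcongr; exacts [Set.toFinite _, hB.subset])
    obtain ⟨b, hbA, hbT⟩ := Set.exists_mem_notMem_of_ncard_lt_ncard (s := T) (t := A) (by omega)
    obtain ⟨a, haT, hab⟩ := hT.surjOn (Set.mem_image_of_mem index hbA)
    obtain rfl := (index_eq_index_iff.1 hab).resolve_left fun h => hbT (h ▸ haT)
    have hcard := Set.ncard_sdiff_singleton_add_one haT
    refine ⟨T \ {a}, Set.sdiff_subset.trans hTA,
      (hTadm.subset Set.sdiff_subset).indep_uniformEnvelope (by omega),
      hTadm.subset Set.sdiff_subset, ?_⟩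
    rw [rankValue_uniformEnvelope_sdiff_singleton hn hTadm hTA (by omega) haT hbA,
      ← (Set.toFinite (T \ {a})).cast_ncard_eq]
    exact_mod_cast (by omega : B.ncard ≤ (T \ {a}).ncard + 2)

lemma isAdmissibleMatroid_uniformEnvelope (hk : 1 ≤ k) (hn : 1 ≤ n) :
    IsAdmissibleMatroid (uniformEnvelope k n) where
  ground_eq := uniformEnvelope_ground
  loopless := by
    rw [Matroid.loopless_iff, Matroid.loops, admissible_empty.closure_uniformEnvelope]
    rwa [Set.ncard_empty]
  rank_eq A := by
    constructor
    · obtain ⟨I, hIA, hI, hadm, hle⟩ := exists_eRk_le_rankValue_uniformEnvelope hn A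
      exact ⟨I, hIA, hI, hadm, hle.antisymm (rankValue_uniformEnvelope_le_eRk hn hIA hI)⟩
    · rintro _ ⟨I, hIA, hI, -, rfl⟩
      exact rankValue_uniformEnvelope_le_eRk hn hIA hI

lemma IsAdmissibleMatroid.almostAdmissible_of_indep (hM : IsAdmissibleMatroid M)
    (hX : M.Indep X) : AlmostAdmissible X := by
  obtain ⟨I, hIX, -, hI, hr⟩ := (hM.rank_eq X).1
  rw [hX.eRk_eq_encard, rankValue] at hr
  split_ifs at hr with h
  · obtain ⟨a, ha, -, h1, h2⟩ := h
    have haI : a ∉ I := notMem_of_insert_star_mem_admIndep h2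
    have hcard : X.ncard = (insert a I).ncard + 1 := by
      rw [Set.ncard_insert_of_notMem haI]
      rw [← (Set.toFinite X).cast_ncard_eq, ← (Set.toFinite I).cast_ncard_eq] at hr
      exact_mod_cast hr
    rw [AlmostAdmissible, hcard, ← (admissible_of_mem_admIndep h1).ncard_index]
    gcongr
    exacts [Set.toFinite _, Set.insert_subset ha hIX]
  · obtain rfl : I = X := (Set.toFinite I).eq_of_subset_of_encard_le hIX hr.le
    exact hI.almostAdmissible

lemma isEnvelopingMatroid_uniformEnvelope (hk : 1 ≤ k) (hkn : k ≤ n) :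
    IsEnvelopingMatroid (uniform k n) (uniformEnvelope k n) where
  admissible := isAdmissibleMatroid_uniformEnvelope hk (hk.trans hkn)
  bases_eq := admissibleBases_uniformEnvelope hkn
  minimal M hM hbases X hX := by
    rw [← Matroid.not_indep_iff (by simp [hM.ground_eq])]
    intro hind
    refine hX.not_indep ⟨?_, hM.almostAdmissible_of_indep hind⟩
    obtain ⟨A, hA, hAk⟩ := exists_admissible_ncard hkn
    have hAbase : A ∈ admissibleBases M := hbases ▸ ⟨hA, hAk⟩
    obtain ⟨B, hB, hXB⟩ := hind.exists_isBase_superset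
    rw [← hAk, ← hB.ncard_eq_ncard_of_isBase hAbase.1]
    exact Set.ncard_le_ncard hXB

lemma IsEnvelopingMatroid.unique {S : Set (Set (Ground n))} {M' : Matroid (Ground n)}
    (h : IsEnvelopingMatroid S M) (h' : IsEnvelopingMatroid S M') : M = M' := by
  have hE : M.E = M'.E := h.admissible.ground_eq.trans h'.admissible.ground_eq.symm
  refine Matroid.ext_indep hE fun X hX => ?_
  rw [← not_iff_not, Matroid.not_indep_iff hX, Matroid.not_indep_iff (hE ▸ hX)]
  exact ⟨h.minimal M' h'.admissible h'.bases_eq X, h'.minimal M h.admissible h.bases_eq X⟩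

end Envelope

/-! ### Signed coordinates -/

/-- The coordinate functional of `ℝⁿ` with value `1` at `signedUnit a` and `-1` at
`signedUnit (star a)`. -/
def coord : Ground n → (Fin n → ℝ) →ₗ[ℝ] ℝ
  | Sum.inl i => LinearMap.proj i
  | Sum.inr i => -LinearMap.proj i

section Coordinates

variable {a b : Ground n} {F : Set (Ground n)} {x y : Fin n → ℝ}

lemma coord_star (a : Ground n) : coord (star a) = -coord a := by
  cases a <;> simp [coord, star]

lemma signedUnit_star (a : Ground n) : signedUnit (star a) = -signedUnit a := by
  cases a <;> simp [signedUnit, star]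

open Classical in
lemma coord_signedUnit (a b : Ground n) :
    coord a (signedUnit b) = (if a = b then 1 else 0) - if star a = b then 1 else 0 := by
  cases a <;> cases b <;> simp [coord, signedUnit, star, Pi.single_apply]

open Classical in
lemma coord_signedVec (a : Ground n) (F : Set (Ground n)) :
    coord a (signedVec F) = (if a ∈ F then 1 else 0) - if star a ∈ F then 1 else 0 := by
  simp only [signedVec, map_sum, coord_signedUnit, Finset.sum_sub_distrib, Finset.sum_ite_eq,
    Finset.mem_filter_univ]

lemma coord_signedVec_of_mem (hF : Admissible F) (ha : a ∈ F) : coord a (signedVec F) = 1 := by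
  simp [coord_signedVec, ha, admissible_iff.1 hF a ha]

lemma coord_signedVec_of_notMem (ha : a ∉ F) (hs : star a ∉ F) : coord a (signedVec F) = 0 := by
  simp [coord_signedVec, ha, hs]

lemma signedVec_empty : signedVec (∅ : Set (Ground n)) = 0 := by
  simp [signedVec]

lemma signedVec_insert (ha : a ∉ F) : signedVec (insert a F) = signedUnit a + signedVec F := by
  classical
  rw [signedVec, signedVec, ← Finset.sum_insert (by simpa using ha)]
  congr 1
  ext b
  simp

lemma mem_integerLattice : x ∈ integerLattice n ↔ ∀ i, ∃ m : ℤ, (m : ℝ) = x i := by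
  constructor
  · rintro ⟨y, rfl⟩ i
    exact ⟨y i, rfl⟩
  · intro h
    choose y hy using h
    exact ⟨y, funext hy⟩

lemma coord_mem_range_intCast (a : Ground n) (hx : x ∈ integerLattice n) :
    coord a x ∈ (Int.castAddHom ℝ).range := by
  cases a with
  | inl i => exact mem_integerLattice.1 hx i
  | inr i => exact neg_mem (mem_integerLattice.1 hx i)

lemma signedUnit_mem_integerLattice (a : Ground n) : signedUnit a ∈ integerLattice n := by
  have single_mem (i : Fin n) : Pi.single i (1 : ℝ) ∈ integerLattice n :=
    mem_integerLattice.2 fun j => ⟨if j = i then 1 else 0, by simp [Pi.single_apply]⟩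
  cases a with
  | inl i => exact single_mem i
  | inr i => exact neg_mem (single_mem i)

lemma signedVec_mem_integerLattice (F : Set (Ground n)) : signedVec F ∈ integerLattice n :=
  sum_mem fun a _ => signedUnit_mem_integerLattice a

/-- The elements of `J` whose signed coordinate is positive at `x`; it recovers `F` from
`signedVec F`. -/
def posSupport (x : Fin n → ℝ) : Set (Ground n) := {a | 0 < coord a x}

lemma posSupport_signedVec (hF : Admissible F) : posSupport (signedVec F) = F := by
  ext a
  constructor
  · intro h
    by_contra ha
    simp only [posSupport, Set.mem_ofPred_eq, coord_signedVec, if_neg ha, zero_sub] at h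
    split_ifs at h <;> norm_num at h
  · intro ha
    simp only [posSupport, Set.mem_ofPred_eq, coord_signedVec_of_mem hF ha, zero_lt_one]

lemma posSupport_zero : posSupport (0 : Fin n → ℝ) = ∅ := by
  simp [posSupport]

lemma posSupport_smul {r : ℝ} (hr : 0 < r) (x : Fin n → ℝ) :
    posSupport (r • x) = posSupport x := by
  simp [posSupport, hr]

lemma posSupport_add_of_subset (h : posSupport x ⊆ posSupport y) :
    posSupport (x + y) = posSupport y := by
  ext a
  have ha := @h a
  have hs := @h (star a)
  simp only [posSupport, Set.mem_ofPred_eq, map_add, coord_star, LinearMap.neg_apply] at *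
  constructor
  · intro hxy
    by_contra hy
    exact hy (ha (by linarith))
  · intro hy
    by_contra hxy
    linarith [hs (by linarith)]

end Coordinates

/-! ### Flags of admissible sets and their cones -/

/-- A flag of admissible sets: a chain of nonempty admissible sets. -/
structure IsFlag (C : Set (Set (Ground n))) : Prop where
  admissible : ∀ F ∈ C, Admissible F
  nonempty : ∀ F ∈ C, F.Nonempty
  isChain : IsChain (· ⊆ ·) C

lemma exists_mem_forall_subset_of_isChain {α : Type*} {C : Set (Set α)}
    (hC : IsChain (· ⊆ ·) C) {G : Set α} (hG : G.Finite) (hne : G.Nonempty) :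
    ∃ a ∈ G, ∀ F ∈ C, a ∈ F → G ⊆ F := by
  by_contra! h
  have hsub : G ⊆ ⋃₀ {F ∈ C | ¬ G ⊆ F} := fun a ha => by
    obtain ⟨F, hF, haF, hGF⟩ := h a ha
    exact ⟨F, ⟨hF, hGF⟩, haF⟩
  have hdir : DirectedOn (· ⊆ ·) {F ∈ C | ¬ G ⊆ F} :=
    (hC.mono fun _ h => h.1).directedOn
  obtain ⟨F, hF, -⟩ := hsub hne.some_mem
  obtain ⟨T, hT, hGT⟩ := hdir.exists_mem_subset_of_finite_of_subset_sUnion ⟨F, hF⟩ hG hsub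
  exact hT.2 hGT

section Cones

variable {C D : Set (Set (Ground n))} {F G : Set (Ground n)} {x u : Fin n → ℝ}

lemma IsFlag.mono (hC : IsFlag C) (h : D ⊆ C) : IsFlag D where
  admissible F hF := hC.admissible F (h hF)
  nonempty F hF := hC.nonempty F (h hF)
  isChain := hC.isChain.mono h

lemma IsFlag.subset_of_ncard_le (hC : IsFlag C) (hF : F ∈ C) (hG : G ∈ C)
    (h : F.ncard ≤ G.ncard) : F ⊆ G := by
  rcases hC.isChain.total hF hG with hFG | hGF
  · exact hFG
  · exact (Set.eq_of_subset_of_ncard_le hGF h).ge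

lemma IsFlag.eq_of_ncard_eq (hC : IsFlag C) (hF : F ∈ C) (hG : G ∈ C)
    (h : F.ncard = G.ncard) : F = G :=
  (hC.subset_of_ncard_le hF hG h.le).antisymm (hC.subset_of_ncard_le hG hF h.ge)

open Classical in
lemma IsFlag.exists_coord_signedVec_eq (hC : IsFlag C) (hG : G ∈ C) :
    ∃ a ∈ G, ∀ F ∈ C, coord a (signedVec F) = if G ⊆ F then 1 else 0 := by
  obtain ⟨a, ha, h⟩ := exists_mem_forall_subset_of_isChain hC.isChain (Set.toFinite G)
    (hC.nonempty G hG)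
  refine ⟨a, ha, fun F hF => ?_⟩
  split_ifs with hGF
  · exact coord_signedVec_of_mem (hC.admissible F hF) (hGF ha)
  · refine coord_signedVec_of_notMem (fun haF => hGF (h F hF haF)) fun hs => ?_
    exact admissible_iff.1 (hC.admissible G hG) a ha ((hC.isChain.total hG hF).resolve_left hGF hs)

lemma IsFlag.exists_separating_functional (hC : IsFlag C) (hG : G ∈ C) :
    ∃ f : (Fin n → ℝ) →ₗ[ℝ] ℝ, (∀ x ∈ integerLattice n, f x ∈ (Int.castAddHom ℝ).range) ∧
      (∀ F ∈ C, F ≠ G → f (signedVec F) = 0) ∧ f (signedVec G) = 1 := by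
  classical
  obtain ⟨a, -, ha⟩ := hC.exists_coord_signedVec_eq hG
  rcases Set.eq_empty_or_nonempty {F ∈ C | G ⊂ F} with hS | hS
  · refine ⟨coord a, fun x => coord_mem_range_intCast a, fun F hF hFG => ?_, by simp [ha G hG]⟩
    rw [ha F hF, if_neg]
    intro hGF
    exact Set.eq_empty_iff_forall_notMem.1 hS F ⟨hF, hGF.ssubset_of_ne hFG.symm⟩
  · obtain ⟨T, ⟨hT, hGT⟩, hmin⟩ := Set.exists_min_image _ Set.ncard (Set.toFinite _) hS
    obtain ⟨b, -, hb⟩ := hC.exists_coord_signedVec_eq hT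
    refine ⟨coord a - coord b, fun x hx => ?_, fun F hF hFG => ?_, ?_⟩
    · exact sub_mem (coord_mem_range_intCast a hx) (coord_mem_range_intCast b hx)
    · have hiff : G ⊆ F ↔ T ⊆ F :=
        ⟨fun hGF => hC.subset_of_ncard_le hT hF (hmin F ⟨hF, hGF.ssubset_of_ne hFG.symm⟩),
          hGT.subset.trans⟩
      rw [LinearMap.sub_apply, ha F hF, hb F hF, if_congr hiff rfl rfl, sub_self]
    · rw [LinearMap.sub_apply, ha G hG, hb G hG, if_pos subset_rfl, if_neg hGT.not_subset,
        sub_zero]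

lemma span_flagCone (C : Set (Set (Ground n))) :
    Submodule.span ℝ (flagCone C : Set (Fin n → ℝ)) = Submodule.span ℝ (signedVec '' C) :=
  Submodule.span_span_of_tower _ _ _

lemma signedVec_mem_flagCone (hF : F ∈ C) : signedVec F ∈ flagCone C :=
  Submodule.subset_span ⟨F, hF, rfl⟩

lemma flagCone_mono (h : D ⊆ C) : flagCone D ≤ flagCone C :=
  Submodule.span_mono (Set.image_mono h)

lemma map_nonneg_of_mem_flagCone {f : (Fin n → ℝ) →ₗ[ℝ] ℝ} (hf : ∀ F ∈ C, 0 ≤ f (signedVec F))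
    (hx : x ∈ flagCone C) : 0 ≤ f x := by
  have hle : flagCone C ≤ (PointedCone.positive ℝ ℝ).comap f := by
    rw [flagCone, PointedCone.hull, Submodule.span_le]
    rintro _ ⟨F, hF, rfl⟩
    exact hf F hF
  exact hle hx

lemma coneDim_flagCone (hC : IsFlag C) : coneDim (flagCone C) = C.ncard := by
  classical
  have hindep : LinearIndepOn ℝ signedVec C := linearIndepOn_iff_notMem_span.2 fun G hG hmem => by
    obtain ⟨f, -, hf0, hf1⟩ := hC.exists_separating_functional hG
    have hle : Submodule.span ℝ (signedVec '' (C \ {G})) ≤ LinearMap.ker f := by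
      rw [Submodule.span_le]
      rintro _ ⟨F, hF, rfl⟩
      exact hf0 F hF.1 hF.2
    exact one_ne_zero (hf1.symm.trans (hle hmem))
  have := Fintype.ofFinite C
  rw [coneDim, span_flagCone, Set.image_eq_range, finrank_span_eq_card hindep,
    ← Nat.card_eq_fintype_card, Nat.card_coe_set_eq]

lemma posSupport_mem_of_mem_flagCone (hC : IsFlag C) (hx : x ∈ flagCone C) :
    posSupport x ∈ insert ∅ C := by
  have hchain : IsChain (· ⊆ ·) (insert ∅ C) :=
    hC.isChain.insert fun F _ _ => Or.inl (Set.empty_subset F)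
  induction hx using Submodule.span_induction with
  | mem x hx =>
    obtain ⟨F, hF, rfl⟩ := hx
    rw [posSupport_signedVec (hC.admissible F hF)]
    exact Set.mem_insert_of_mem ∅ hF
  | zero => exact Or.inl posSupport_zero
  | add x y _ _ hx hy =>
    rcases hchain.total hx hy with h | h
    · rwa [posSupport_add_of_subset h]
    · rwa [add_comm, posSupport_add_of_subset h]
  | smul r x _ hx =>
    rw [Nonneg.mk_smul r.1 r.2]
    rcases r.2.eq_or_lt' with hr | hr
    · exact Or.inl (by rw [hr, zero_smul, posSupport_zero])
    · rwa [posSupport_smul hr]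

lemma flagCone_le_iff (hC : IsFlag C) (hD : IsFlag D) : flagCone D ≤ flagCone C ↔ D ⊆ C := by
  refine ⟨fun h F hF => ?_, flagCone_mono⟩
  have hmem := posSupport_mem_of_mem_flagCone hC (h (signedVec_mem_flagCone hF))
  rw [posSupport_signedVec (hD.admissible F hF)] at hmem
  exact hmem.resolve_left (hD.nonempty F hF).ne_empty

lemma flagCone_inj (hC : IsFlag C) (hD : IsFlag D) : flagCone C = flagCone D ↔ C = D := by
  rw [le_antisymm_iff, flagCone_le_iff hD hC, flagCone_le_iff hC hD, subset_antisymm_iff]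

/-! ### Normal vectors of flag cones -/

lemma sub_smul_mem_span_of_mem_span_insert {R M : Type*} [CommRing R] [AddCommGroup M] [Module R M]
    {f : M →ₗ[R] R} {S : Set M} {v x : M} (hS : ∀ y ∈ S, f y = 0) (hv : f v = 1)
    (hx : x ∈ Submodule.span R (insert v S)) : x - f x • v ∈ Submodule.span R S := by
  have hker : Submodule.span R S ≤ LinearMap.ker f := Submodule.span_le.2 hS
  obtain ⟨r, y, hy, rfl⟩ := Submodule.mem_span_insert.1 hx
  simpa [hv, LinearMap.mem_ker.1 (hker hy)] using hy

lemma mem_coneLattice_flagCone : x ∈ coneLattice (flagCone C) ↔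
    x ∈ integerLattice n ∧ x ∈ Submodule.span ℝ (signedVec '' C) := by
  rw [coneLattice, span_flagCone]
  rfl

lemma signedVec_mem_coneLattice (hF : F ∈ C) : signedVec F ∈ coneLattice (flagCone C) :=
  mem_coneLattice_flagCone.2
    ⟨signedVec_mem_integerLattice F, Submodule.subset_span (Set.mem_image_of_mem signedVec hF)⟩

lemma IsFlag.exists_integral_functional (hC : IsFlag (insert G D)) (hG : G ∉ D) :
    ∃ f : (Fin n → ℝ) →ₗ[ℝ] ℝ, (∀ x ∈ integerLattice n, f x ∈ (Int.castAddHom ℝ).range) ∧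
      (∀ y ∈ signedVec '' D, f y = 0) ∧ f (signedVec G) = 1 := by
  obtain ⟨f, hfZ, hf0, hf1⟩ := hC.exists_separating_functional (Set.mem_insert G D)
  refine ⟨f, hfZ, ?_, hf1⟩
  rintro _ ⟨F, hF, rfl⟩
  exact hf0 F (Set.mem_insert_of_mem G hF) (ne_of_mem_of_not_mem hF hG)

lemma isNormalVector_signedVec (hC : IsFlag (insert G D)) (hG : G ∉ D) :
    IsNormalVector (flagCone D) (flagCone (insert G D)) (signedVec G) := by
  refine ⟨signedVec_mem_flagCone (Set.mem_insert G D), le_antisymm (fun x hx => ?_) ?_⟩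
  · obtain ⟨f, hfZ, hf0, hf1⟩ := hC.exists_integral_functional hG
    obtain ⟨hxZ, hxspan⟩ := mem_coneLattice_flagCone.1 hx
    rw [Set.image_insert_eq] at hxspan
    obtain ⟨m, hm : (m : ℝ) = f x⟩ := hfZ x hxZ
    have hdiff := sub_smul_mem_span_of_mem_span_insert hf0 hf1 hxspan
    rw [← hm, Int.cast_smul_eq_zsmul] at hdiff
    refine AddSubgroup.mem_sup.2 ⟨x - m • signedVec G, mem_coneLattice_flagCone.2 ⟨?_, hdiff⟩,
      m • signedVec G, ⟨m, rfl⟩, sub_add_cancel _ _⟩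
    exact sub_mem hxZ (zsmul_mem (signedVec_mem_integerLattice G) m)
  · refine sup_le (fun x hx => ?_) ?_
    · rw [mem_coneLattice_flagCone] at hx ⊢
      exact ⟨hx.1, Submodule.span_mono (Set.image_mono (Set.subset_insert G D)) hx.2⟩
    · rw [AddSubgroup.zmultiples_le]
      exact signedVec_mem_coneLattice (Set.mem_insert G D)

lemma IsNormalVector.sub_signedVec_mem_span (hC : IsFlag (insert G D)) (hG : G ∉ D)
    (hu : IsNormalVector (flagCone D) (flagCone (insert G D)) u) :
    u - signedVec G ∈ Submodule.span ℝ (signedVec '' D) := by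
  obtain ⟨f, hfZ, hf0, hf1⟩ := hC.exists_integral_functional hG
  have hker : Submodule.span ℝ (signedVec '' D) ≤ LinearMap.ker f := Submodule.span_le.2 hf0
  have hulat : u ∈ coneLattice (flagCone (insert G D)) :=
    hu.2 ▸ AddSubgroup.mem_sup_right (AddSubgroup.mem_zmultiples u)
  obtain ⟨huZ, huspan⟩ := mem_coneLattice_flagCone.1 hulat
  rw [Set.image_insert_eq] at huspan
  obtain ⟨m, hm : (m : ℝ) = f u⟩ := hfZ u huZ
  have hm_nonneg : 0 ≤ m := by
    have hfu : 0 ≤ f u := map_nonneg_of_mem_flagCone (by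
      rintro F (rfl | hF)
      · exact hf1.ge.trans' zero_le_one
      · exact (hf0 _ (Set.mem_image_of_mem signedVec hF)).ge) hu.1
    exact_mod_cast hm.symm ▸ hfu
  obtain ⟨j, hj⟩ : ∃ j : ℤ, j * m = 1 := by
    have hGlat := signedVec_mem_coneLattice (Set.mem_insert G D)
    rw [hu.2] at hGlat
    obtain ⟨t, ht, _, ⟨j, rfl⟩, htj : t + j • u = signedVec G⟩ := AddSubgroup.mem_sup.1 hGlat
    have hft : f t = 0 := hker (mem_coneLattice_flagCone.1 ht).2
    have hfG := congrArg f htj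
    rw [map_add, hft, zero_add, map_zsmul, ← hm, hf1, zsmul_eq_mul] at hfG
    exact ⟨j, by exact_mod_cast hfG⟩
  have hm1 : m = 1 := Int.eq_one_of_dvd_one hm_nonneg ⟨j, by rw [mul_comm, hj]⟩
  simpa [← hm, hm1] using sub_smul_mem_span_of_mem_span_insert hf0 hf1 huspan

end Cones

/-! ### The fan of flags and its balancing condition -/

/-- The fan of the cones of all flags of admissible sets with at most `d` elements. It is the
Bergman fan of `U*_{d+1,n}`. -/
def flagFan (n d : ℕ) : Set (PointedCone ℝ (Fin n → ℝ)) :=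
  {σ | ∃ C : Set (Set (Ground n)), IsFlag C ∧ (∀ F ∈ C, F.ncard ≤ d) ∧ σ = flagCone C}

/-- A complete flag: a flag of `d` admissible sets with at most `d` elements each, hence with one
set of each size `1, …, d`. These flags give the `d`-dimensional cones of `flagFan n d`. -/
structure IsCompleteFlag (d : ℕ) (C : Set (Set (Ground n))) : Prop extends IsFlag C where
  ncard_le : ∀ F ∈ C, F.ncard ≤ d
  ncard_eq : C.ncard = d

/-- The sets that complete `D` to a complete flag. -/
def flagExtensions (d : ℕ) (D : Set (Set (Ground n))) : Set (Set (Ground n)) :=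
  {G | G ∉ D ∧ IsCompleteFlag d (insert G D)}

/-- The weight of the cone spanned by `C`; the value is `0` unless this is one of the
`d`-dimensional cones of the fan. -/
noncomputable def flagWeight {d : ℕ} (c : conesOfDim (flagFan n d) d → ℤ)
    (C : Set (Set (Ground n))) : ℤ :=
  Function.extend Subtype.val c 0 (flagCone C)

section Balancing

variable {d : ℕ} {C D : Set (Set (Ground n))} {G : Set (Ground n)}
  {c : conesOfDim (flagFan n d) d → ℤ}

lemma mem_conesOfDim_flagFan_iff {σ : PointedCone ℝ (Fin n → ℝ)} :
    σ ∈ conesOfDim (flagFan n d) d ↔ ∃ C, IsCompleteFlag d C ∧ flagCone C = σ := by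
  constructor
  · rintro ⟨⟨C, hC, hle, rfl⟩, hd⟩
    exact ⟨C, ⟨hC, hle, (coneDim_flagCone hC).symm.trans hd⟩, rfl⟩
  · rintro ⟨C, hC, rfl⟩
    exact ⟨⟨C, hC.toIsFlag, hC.ncard_le, rfl⟩, (coneDim_flagCone hC.toIsFlag).trans hC.ncard_eq⟩

lemma IsCompleteFlag.flagCone_mem (hC : IsCompleteFlag d C) :
    flagCone C ∈ conesOfDim (flagFan n d) d :=
  mem_conesOfDim_flagFan_iff.2 ⟨C, hC, rfl⟩

lemma flagWeight_eq (hC : flagCone C ∈ conesOfDim (flagFan n d) d) :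
    flagWeight c C = c ⟨flagCone C, hC⟩ :=
  Subtype.val_injective.extend_apply c 0 ⟨flagCone C, hC⟩

lemma IsFlag.exists_insert_eq (hD : IsFlag D) (hd : D.ncard + 1 = d) (hC : IsCompleteFlag d C)
    (h : flagCone D ≤ flagCone C) : ∃ G ∉ D, insert G D = C :=
  (Set.exists_eq_insert_iff_ncard (Set.toFinite D)).2
    ⟨(flagCone_le_iff hC.toIsFlag hD).1 h, hd.trans hC.ncard_eq.symm⟩

/-- The `d`-dimensional cones containing the cone of a flag `D` with `d - 1` members correspond to
the sets that complete `D`. -/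
noncomputable def flagExtensionsEquiv (hD : IsFlag D) (hd : D.ncard + 1 = d) :
    flagExtensions d D ≃ {σ : conesOfDim (flagFan n d) d // flagCone D ≤ σ.1} :=
  Equiv.ofBijective
    (fun G => ⟨⟨flagCone (insert G.1 D), G.2.2.flagCone_mem⟩,
      flagCone_mono (Set.subset_insert _ _)⟩)
    (by
      constructor
      · intro G G' h
        have hcone : flagCone (insert G.1 D) = flagCone (insert G'.1 D) :=
          congrArg (fun σ => σ.1.1) h
        rw [flagCone_inj G.2.2.toIsFlag G'.2.2.toIsFlag] at hcone
        exact Subtype.ext ((Set.insert_inj G.2.1).1 hcone)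
      · rintro ⟨⟨σ, hσ⟩, hle⟩
        obtain ⟨C, hC, rfl⟩ := mem_conesOfDim_flagFan_iff.1 hσ
        obtain ⟨G, hG, rfl⟩ := hD.exists_insert_eq hd hC hle
        exact ⟨⟨G, hG, hC⟩, rfl⟩)

lemma mkQ_finsum_normalVector (hD : IsFlag D) (hd : D.ncard + 1 = d)
    {u : conesOfDim (flagFan n d) d → (Fin n → ℝ)}
    (hu : ∀ σ : conesOfDim (flagFan n d) d, flagCone D ≤ σ.1 →
      IsNormalVector (flagCone D) σ.1 (u σ)) :
    (Submodule.span ℝ (signedVec '' D)).mkQ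
        (∑ᶠ (σ : conesOfDim (flagFan n d) d) (_ : flagCone D ≤ σ.1), c σ • u σ) =
      (Submodule.span ℝ (signedVec '' D)).mkQ
        (∑ᶠ G : flagExtensions d D, flagWeight c (insert G.1 D) • signedVec G.1) := by
  rw [← finsum_subtype_eq_finsum_cond, ← finsum_comp_equiv (flagExtensionsEquiv hD hd),
    map_finsum _ (Set.toFinite _), map_finsum _ (Set.toFinite _)]
  refine finsum_congr fun G => ?_
  have hnormal := hu (flagExtensionsEquiv hD hd G).1 (flagExtensionsEquiv hD hd G).2
  rw [map_zsmul, map_zsmul, flagWeight_eq G.2.2.flagCone_mem]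
  congr 1
  exact (Submodule.Quotient.eq _).2 (hnormal.sub_signedVec_mem_span G.2.2.toIsFlag G.2.1)

lemma finsum_normalVector_mem_span_iff (hD : IsFlag D) (hd : D.ncard + 1 = d)
    {u : conesOfDim (flagFan n d) d → (Fin n → ℝ)}
    (hu : ∀ σ : conesOfDim (flagFan n d) d, flagCone D ≤ σ.1 →
      IsNormalVector (flagCone D) σ.1 (u σ)) :
    ∑ᶠ (σ : conesOfDim (flagFan n d) d) (_ : flagCone D ≤ σ.1), c σ • u σ ∈
        Submodule.span ℝ (flagCone D : Set (Fin n → ℝ)) ↔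
      ∑ᶠ G : flagExtensions d D, flagWeight c (insert G.1 D) • signedVec G.1 ∈
        Submodule.span ℝ (signedVec '' D) := by
  rw [span_flagCone, ← Submodule.Quotient.mk_eq_zero, ← Submodule.mkQ_apply,
    mkQ_finsum_normalVector hD hd hu, Submodule.mkQ_apply, Submodule.Quotient.mk_eq_zero]

lemma exists_isNormalVector (hD : IsFlag D) (hd : D.ncard + 1 = d)
    (σ : conesOfDim (flagFan n d) d) (h : flagCone D ≤ σ.1) :
    ∃ u, IsNormalVector (flagCone D) σ.1 u := by
  obtain ⟨C, hC, hσ⟩ := mem_conesOfDim_flagFan_iff.1 σ.2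
  rw [← hσ] at h ⊢
  obtain ⟨G, hG, rfl⟩ := hD.exists_insert_eq hd hC h
  exact ⟨signedVec G, isNormalVector_signedVec hC.toIsFlag hG⟩

lemma isBalanced_iff : IsBalanced (flagFan n d) d c ↔ ∀ D : Set (Set (Ground n)),
    ∑ᶠ G : flagExtensions d D, flagWeight c (insert G.1 D) • signedVec G.1 ∈
      Submodule.span ℝ (signedVec '' D) := by
  constructor
  · intro h D
    rcases isEmpty_or_nonempty (flagExtensions d D) with hempty | ⟨⟨G, hG, hC⟩⟩
    · rw [finsum_of_isEmpty]
      exact zero_mem _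
    have hD : IsFlag D := hC.toIsFlag.mono (Set.subset_insert G D)
    have hd : D.ncard + 1 = d := (Set.ncard_insert_of_notMem hG).symm.trans hC.ncard_eq
    have hfan : flagCone D ∈ flagFan n d :=
      ⟨D, hD, fun F hF => hC.ncard_le F (Set.mem_insert_of_mem G hF), rfl⟩
    choose! u hu using exists_isNormalVector hD hd
    rw [← finsum_normalVector_mem_span_iff hD hd hu]
    exact h _ hfan (by rw [coneDim_flagCone hD, hd]) u hu
  · rintro h τ ⟨D, hD, -, rfl⟩ hd u hu
    rw [coneDim_flagCone hD] at hd
    rw [finsum_normalVector_mem_span_iff hD hd hu]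
    exact h D

end Balancing

/-! ### Balancing for vectors that occur in opposite pairs -/

section Opposite

variable {K M ι : Type*} [Field K] [AddCommGroup M] [Module K M] {W : Submodule K M} {v : ι → M}
  {j k k' : ι}

/-- `k` is an opposite of `j` modulo `W` if `v j` and `v k` are opposite modulo `W` and some
functional on the quotient by `W` takes the value `1` at `v j` and vanishes at all vectors other
than `v j` and `v k`. -/
def IsOpposite (W : Submodule K M) (v : ι → M) (j k : ι) : Prop :=
  v j + v k ∈ W ∧ ∃ f : M →ₗ[K] K, W ≤ LinearMap.ker f ∧ f (v j) = 1 ∧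
    ∀ l, l ≠ j → l ≠ k → f (v l) = 0

variable [CharZero K]

lemma IsOpposite.eq_of_add_mem (h : IsOpposite W v j k) (hW : v j + v k' ∈ W) : k' = k := by
  obtain ⟨-, f, hf, hj, h0⟩ := h
  have hadd : f (v j) + f (v k') = 0 := by rw [← map_add]; exact hf hW
  by_contra hk
  by_cases hkj : k' = j
  · norm_num [hkj, hj] at hadd
  · norm_num [h0 k' hkj hk, hj] at hadd

open Classical in
lemma IsOpposite.exists_functional (h : IsOpposite W v j k) :
    ∃ f : M →ₗ[K] K, W ≤ LinearMap.ker f ∧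
      ∀ l, f (v l) = (if l = j then 1 else 0) - if l = k then 1 else 0 := by
  obtain ⟨hW, f, hf, hj, h0⟩ := h
  have hadd : f (v j) + f (v k) = 0 := by rw [← map_add]; exact hf hW
  have hjk : j ≠ k := by
    rintro rfl
    norm_num [hj] at hadd
  refine ⟨f, hf, fun l => ?_⟩
  by_cases hlj : l = j
  · rw [hlj, hj, if_pos rfl, if_neg hjk, sub_zero]
  by_cases hlk : l = k
  · rw [hlk, if_neg hjk.symm, if_pos rfl, zero_sub, ← hj, eq_neg_of_add_eq_zero_right hadd]
  · rw [h0 l hlj hlk, if_neg hlj, if_neg hlk, sub_zero]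

theorem sum_zsmul_mem_iff [Fintype ι] (h : ∀ j, ∃ k, IsOpposite W v j k) (w : ι → ℤ) :
    ∑ j, w j • v j ∈ W ↔ ∀ j k, v j + v k ∈ W → w j = w k := by
  classical
  choose opp hopp using h
  constructor
  · intro hsum j k hjk
    obtain rfl := (hopp j).eq_of_add_mem hjk
    obtain ⟨f, hf, hval⟩ := (hopp j).exists_functional
    have hzero : f (∑ l, w l • v l) = 0 := hf hsum
    simp only [map_sum, map_zsmul, hval, smul_sub, zsmul_eq_mul, mul_ite, mul_one, mul_zero,
      Finset.sum_sub_distrib, Finset.sum_ite_eq', Finset.mem_univ, if_true, sub_eq_zero] at hzero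
    exact_mod_cast hzero
  · intro hw
    have hinv : Function.Involutive opp := fun j =>
      ((hopp (opp j)).eq_of_add_mem (add_comm (v j) _ ▸ (hopp j).1)).symm
    have htwo : (2 : K) • ∑ j, w j • v j = ∑ j, w j • (v j + v (opp j)) := by
      rw [two_smul]
      nth_rw 2 [← Equiv.sum_comp hinv.toPerm]
      rw [← Finset.sum_add_distrib]
      refine Finset.sum_congr rfl fun j _ => ?_
      rw [smul_add, Function.Involutive.coe_toPerm, hw j (opp j) (hopp j).1]
    rw [← W.smul_mem_iff (two_ne_zero (α := K)), htwo]
    exact sum_mem fun j _ => zsmul_mem (hopp j).1 (w j)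

end Opposite

/-! ### Opposite extensions of a flag -/

section Extensions

variable {d : ℕ} {C D : Set (Set (Ground n))} {G G' H : Set (Ground n)}
  {c : conesOfDim (flagFan n d) d → ℤ}

lemma IsCompleteFlag.ncard_image (hC : IsCompleteFlag d C) : Set.ncard '' C = Set.Icc 1 d := by
  have hinj : Set.InjOn Set.ncard C := fun F hF G hG h => hC.eq_of_ncard_eq hF hG h
  refine Set.eq_of_subset_of_ncard_le ?_ ?_ (Set.finite_Icc 1 d)
  · rintro _ ⟨F, hF, rfl⟩
    exact ⟨(Set.ncard_pos (Set.toFinite F)).2 (hC.nonempty F hF), hC.ncard_le F hF⟩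
  · rw [hinj.ncard_image, hC.ncard_eq, ← Finset.coe_Icc, Set.ncard_coe_finset, Nat.card_Icc,
      Nat.add_sub_cancel]

lemma IsCompleteFlag.exists_ncard_eq (hC : IsCompleteFlag d C) {i : ℕ} (h1 : 1 ≤ i) (hd : i ≤ d) :
    ∃ F ∈ C, F.ncard = i := by
  have hi : i ∈ Set.ncard '' C := hC.ncard_image ▸ ⟨h1, hd⟩
  exact hi

lemma ncard_eq_of_mem_flagExtensions (hG : G ∈ flagExtensions d D) (hH : H ∈ flagExtensions d D) :
    H.ncard = G.ncard := by
  have hmem : G.ncard ∈ Set.ncard '' insert H D := by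
    rw [hH.2.ncard_image, ← hG.2.ncard_image]
    exact Set.mem_image_of_mem _ (Set.mem_insert G D)
  obtain ⟨F, rfl | hF, hcard⟩ := hmem
  · exact hcard
  · have hFG := hG.2.eq_of_ncard_eq (Set.mem_insert_of_mem G hF) (Set.mem_insert G D) hcard
    exact absurd (hFG ▸ hF) hG.1

lemma mem_flagExtensions_of_comparable (hG : G ∈ flagExtensions d D) (hadm : Admissible G')
    (hcard : G'.ncard = G.ncard) (hcomp : ∀ F ∈ D, F ⊆ G' ∨ G' ⊆ F) :
    G' ∈ flagExtensions d D := by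
  obtain ⟨hGD, hC⟩ := hG
  have hGmem : G ∈ insert G D := Set.mem_insert G D
  have hG'D : G' ∉ D := fun h =>
    hGD (hC.eq_of_ncard_eq (Set.mem_insert_of_mem G h) hGmem hcard ▸ h)
  refine ⟨hG'D, ⟨?_, ?_, ?_⟩, ?_, ?_⟩
  · rintro F (rfl | hF)
    exacts [hadm, hC.admissible F (Set.mem_insert_of_mem G hF)]
  · rintro F (rfl | hF)
    · rw [← Set.ncard_pos, hcard, Set.ncard_pos]
      exact hC.nonempty G hGmem
    · exact hC.nonempty F (Set.mem_insert_of_mem G hF)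
  · exact (hC.isChain.mono (Set.subset_insert G D)).insert fun F hF _ => (hcomp F hF).symm
  · rintro F (rfl | hF)
    exacts [hcard.trans_le (hC.ncard_le G hGmem), hC.ncard_le F (Set.mem_insert_of_mem G hF)]
  · rw [Set.ncard_insert_of_notMem hG'D, ← Set.ncard_insert_of_notMem hGD, hC.ncard_eq]

lemma exists_lower_neighbour (hG : G ∈ flagExtensions d D) :
    ∃ L, signedVec L ∈ Submodule.span ℝ (signedVec '' D) ∧ (∀ F ∈ D, F ⊆ G → F ⊆ L) ∧
      ∀ H ∈ flagExtensions d D, ∃ x ∉ L, insert x L = H := by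
  obtain ⟨hGD, hC⟩ := hG
  have hGmem : G ∈ insert G D := Set.mem_insert G D
  have hlt : ∀ F ∈ D, F ⊆ G → F.ncard < G.ncard := fun F hF hFG =>
    Set.ncard_lt_ncard (hFG.ssubset_of_ne (ne_of_mem_of_not_mem hF hGD))
  have hpos : 0 < G.ncard := (Set.ncard_pos (Set.toFinite G)).2 (hC.nonempty G hGmem)
  rcases Nat.eq_or_lt_of_le (Nat.succ_le_of_lt hpos) with hone | hone
  · refine ⟨∅, signedVec_empty ▸ zero_mem _, fun F hF hFG => ?_, fun H hH => ?_⟩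
    · have hcard : F.ncard = 0 := by have := hlt F hF hFG; omega
      exact ((Set.ncard_eq_zero (Set.toFinite F)).1 hcard).subset
    · obtain ⟨x, rfl⟩ := Set.ncard_eq_one.1
        ((ncard_eq_of_mem_flagExtensions ⟨hGD, hC⟩ hH).trans hone.symm)
      exact ⟨x, Set.notMem_empty x, insert_empty_eq x⟩
  · obtain ⟨L, hLC, hL⟩ := hC.exists_ncard_eq (i := G.ncard - 1) (by omega)
      (by have := hC.ncard_le G hGmem; omega)
    have hLD : L ∈ D := hLC.resolve_left fun h => by subst h; omega
    refine ⟨L, Submodule.subset_span (Set.mem_image_of_mem _ hLD), fun F hF hFG => ?_,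
      fun H hH => ?_⟩
    · exact hC.subset_of_ncard_le (Set.mem_insert_of_mem G hF) hLC
        (hL ▸ Nat.le_sub_one_of_lt (hlt F hF hFG))
    · have hcard := ncard_eq_of_mem_flagExtensions ⟨hGD, hC⟩ hH
      refine (Set.exists_eq_insert_iff_ncard (Set.toFinite L)).2 ⟨?_, by omega⟩
      exact hH.2.subset_of_ncard_le (Set.mem_insert_of_mem H hLD) (Set.mem_insert H D) (by omega)

lemma exists_upper_neighbour (hG : G ∈ flagExtensions d D) (hd : G.ncard < d) :
    ∃ T ∈ D, (∀ F ∈ D, G ⊆ F → T ⊆ F) ∧ ∀ H ∈ flagExtensions d D, ∃ x ∉ H, insert x H = T := by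
  obtain ⟨T, hTC, hT⟩ := hG.2.exists_ncard_eq (Nat.le_add_left 1 G.ncard) hd
  have hTD : T ∈ D := hTC.resolve_left fun h => by subst h; omega
  refine ⟨T, hTD, fun F hF hGF => ?_, fun H hH => ?_⟩
  · refine hG.2.subset_of_ncard_le hTC (Set.mem_insert_of_mem G hF) (hT ▸ ?_)
    exact Set.ncard_lt_ncard (hGF.ssubset_of_ne (ne_of_mem_of_not_mem hF hG.1).symm)
  · have hcard := ncard_eq_of_mem_flagExtensions hG hH
    refine (Set.exists_eq_insert_iff_ncard (Set.toFinite H)).2 ⟨?_, by omega⟩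
    exact hH.2.subset_of_ncard_le (Set.mem_insert H D) (Set.mem_insert_of_mem H hTD) (by omega)

lemma exists_isOpposite_of_ncard_eq (G : flagExtensions d D) (hd : G.1.ncard = d) :
    ∃ G', IsOpposite (Submodule.span ℝ (signedVec '' D))
      (fun H : flagExtensions d D => signedVec H.1) G G' := by
  obtain ⟨L, hLspan, hL, hext⟩ := exists_lower_neighbour G.2
  obtain ⟨a, haL, haG⟩ := hext G.1 G.2
  have hC := G.2.2
  have hadm : Admissible (insert a L) := haG ▸ hC.admissible _ (Set.mem_insert _ D)
  have hsL : star a ∉ L := hadm.star_notMem_of_insert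
  have hDL : ∀ F ∈ D, F ⊆ L := fun F hF => hL F hF <|
    hC.subset_of_ncard_le (Set.mem_insert_of_mem _ hF) (Set.mem_insert _ D)
      ((hC.ncard_le F (Set.mem_insert_of_mem _ hF)).trans_eq hd.symm)
  have hstar : insert (star a) L ∈ flagExtensions d D := by
    refine mem_flagExtensions_of_comparable G.2 (hadm.insert_star haL) ?_
      fun F hF => Or.inl ((hDL F hF).trans (Set.subset_insert _ L))
    rw [← haG, Set.ncard_insert_of_notMem hsL, Set.ncard_insert_of_notMem haL]
  refine ⟨⟨_, hstar⟩, ?_, coord a, Submodule.span_le.2 ?_, ?_, fun H hHG hHG' => ?_⟩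
  · have hsum : signedVec G.1 + signedVec (insert (star a) L) = signedVec L + signedVec L := by
      rw [← haG, signedVec_insert haL, signedVec_insert hsL, signedUnit_star]
      abel
    exact hsum ▸ add_mem hLspan hLspan
  · rintro _ ⟨F, hF, rfl⟩
    exact coord_signedVec_of_notMem (fun h => haL (hDL F hF h)) (fun h => hsL (hDL F hF h))
  · exact coord_signedVec_of_mem (haG ▸ hadm) (haG ▸ Set.mem_insert a L)
  · obtain ⟨x, -, hx⟩ := hext H.1 H.2
    refine coord_signedVec_of_notMem ?_ ?_ <;> rw [← hx, Set.mem_insert_iff, not_or]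
    · exact ⟨fun h => hHG (Subtype.ext (by rw [← hx, ← haG, h])), haL⟩
    · exact ⟨fun h => hHG' (Subtype.ext (by rw [← hx, ← h])), hsL⟩

lemma exists_isOpposite_of_ncard_lt (G : flagExtensions d D) (hd : G.1.ncard < d) :
    ∃ G', IsOpposite (Submodule.span ℝ (signedVec '' D))
      (fun H : flagExtensions d D => signedVec H.1) G G' := by
  obtain ⟨L, hLspan, hL, hLext⟩ := exists_lower_neighbour G.2
  obtain ⟨T, hTD, hT, hText⟩ := exists_upper_neighbour G.2 hd
  obtain ⟨a, haL, haG⟩ := hLext G.1 G.2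
  obtain ⟨b, hbG, hbT⟩ := hText G.1 G.2
  have hbL : b ∉ L := fun h => hbG (haG ▸ Set.mem_insert_of_mem a h)
  have hTabL : T = insert a (insert b L) := by rw [← hbT, ← haG, Set.insert_comm]
  have haL' : a ∉ insert b L := by
    rintro (rfl | h)
    exacts [hbG (haG ▸ Set.mem_insert a L), haL h]
  have hG' : insert b L ∈ flagExtensions d D := by
    have hbLT : insert b L ⊆ T := hTabL ▸ Set.subset_insert a _
    refine mem_flagExtensions_of_comparable G.2
      ((G.2.2.admissible T (Set.mem_insert_of_mem _ hTD)).subset hbLT) ?_ fun F hF => ?_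
    · rw [← haG, Set.ncard_insert_of_notMem hbL, Set.ncard_insert_of_notMem haL]
    · refine (G.2.2.isChain.total (Set.mem_insert_of_mem _ hF) (Set.mem_insert _ D)).imp ?_ ?_
      exacts [fun h => (hL F hF h).trans (Set.subset_insert b L), fun h => hbLT.trans (hT F hF h)]
  obtain ⟨f, -, hf0, hf1⟩ := G.2.2.toIsFlag.exists_integral_functional G.2.1
  refine ⟨⟨_, hG'⟩, ?_, f, Submodule.span_le.2 hf0, hf1, fun H hHG hHG' => ?_⟩
  · have hsum : signedVec G.1 + signedVec (insert b L) = signedVec T + signedVec L := by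
      rw [hTabL, ← haG, signedVec_insert haL, signedVec_insert haL']
      abel
    exact hsum ▸ add_mem (Submodule.subset_span (Set.mem_image_of_mem _ hTD)) hLspan
  · obtain ⟨x, hxL, hx⟩ := hLext H.1 H.2
    obtain ⟨y, -, hy⟩ := hText H.1 H.2
    have hxT : x ∈ insert a (insert b L) := hTabL ▸ hy ▸ hx ▸ Or.inr (Set.mem_insert x L)
    rcases hxT with rfl | rfl | h
    · exact absurd (Subtype.ext (hx.symm.trans haG)) hHG
    · exact absurd (Subtype.ext hx.symm) hHG'
    · exact absurd h hxL

lemma exists_isOpposite (G : flagExtensions d D) :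
    ∃ G', IsOpposite (Submodule.span ℝ (signedVec '' D))
      (fun H : flagExtensions d D => signedVec H.1) G G' :=
  (G.2.2.ncard_le G.1 (Set.mem_insert _ D)).eq_or_lt.elim
    (exists_isOpposite_of_ncard_eq G) (exists_isOpposite_of_ncard_lt G)

lemma isBalanced_iff_flagWeight_eq : IsBalanced (flagFan n d) d c ↔
    ∀ D : Set (Set (Ground n)), ∀ G ∈ flagExtensions d D, ∀ G' ∈ flagExtensions d D,
      signedVec G + signedVec G' ∈ Submodule.span ℝ (signedVec '' D) →
        flagWeight c (insert G D) = flagWeight c (insert G' D) := by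
  rw [isBalanced_iff]
  refine forall_congr' fun D => ?_
  have := Fintype.ofFinite (flagExtensions d D)
  rw [finsum_eq_sum_of_fintype, sum_zsmul_mem_iff exists_isOpposite]
  simp only [Subtype.forall]

end Extensions

/-! ### Supports of cones -/

open Classical in
/-- The coordinates that do not vanish identically on `σ`. For the cone of a flag these are the
indices of the elements of its members; every Minkowski weight is a function of them. -/
noncomputable def coneSupport (σ : PointedCone ℝ (Fin n → ℝ)) : Finset (Fin n) :=
  {i | ∃ x ∈ σ, x i ≠ 0}

section Support

variable {d : ℕ} {C D : Set (Set (Ground n))} {G G' : Set (Ground n)}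

lemma coord_ne_zero_iff {a : Ground n} {x : Fin n → ℝ} : coord a x ≠ 0 ↔ x (index a) ≠ 0 := by
  cases a <;> simp [coord]

lemma mem_coneSupport_flagCone (hC : ∀ F ∈ C, Admissible F) {i : Fin n} :
    i ∈ coneSupport (flagCone C) ↔ ∃ F ∈ C, i ∈ index '' F := by
  simp only [coneSupport, Finset.mem_filter_univ]
  constructor
  · contrapose!
    intro h x hx
    have hle : Submodule.span ℝ (signedVec '' C) ≤ LinearMap.ker (coord (Sum.inl i)) := by
      rw [Submodule.span_le]
      rintro _ ⟨F, hF, rfl⟩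
      exact coord_signedVec_of_notMem (fun hi => h F hF ⟨_, hi, rfl⟩)
        (fun hi => h F hF ⟨_, hi, rfl⟩)
    exact hle (span_flagCone C ▸ Submodule.subset_span hx)
  · rintro ⟨F, hF, a, ha, rfl⟩
    refine ⟨signedVec F, signedVec_mem_flagCone hF, coord_ne_zero_iff.1 ?_⟩
    rw [coord_signedVec_of_mem (hC F hF) ha]
    exact one_ne_zero

lemma coneSupport_flagCone_insert_subset (hG : ∀ F ∈ insert G D, Admissible F)
    (hG' : ∀ F ∈ insert G' D, Admissible F)
    (h : signedVec G + signedVec G' ∈ Submodule.span ℝ (signedVec '' D)) :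
    coneSupport (flagCone (insert G D)) ⊆ coneSupport (flagCone (insert G' D)) := by
  intro i hi
  rw [mem_coneSupport_flagCone hG] at hi
  rw [mem_coneSupport_flagCone hG']
  obtain ⟨F, rfl | hF, a, ha, rfl⟩ := hi
  · by_contra! hnot
    have hzero : ∀ H ∈ insert G' D, coord a (signedVec H) = 0 := fun H hH =>
      coord_signedVec_of_notMem (fun haH => hnot H hH ⟨a, haH, rfl⟩)
        (fun hs => hnot H hH ⟨star a, hs, index_star a⟩)
    have hle : Submodule.span ℝ (signedVec '' D) ≤ LinearMap.ker (coord a) := by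
      rw [Submodule.span_le]
      rintro _ ⟨H, hH, rfl⟩
      exact hzero H (Set.mem_insert_of_mem G' hH)
    have hsum : coord a (signedVec F + signedVec G') = 0 := hle h
    rw [map_add, coord_signedVec_of_mem (hG F (Set.mem_insert F D)) ha,
      hzero G' (Set.mem_insert G' D), add_zero] at hsum
    exact one_ne_zero hsum
  · exact ⟨F, Set.mem_insert_of_mem G' hF, a, ha, rfl⟩

lemma coneSupport_flagCone_insert_eq (hG : ∀ F ∈ insert G D, Admissible F)
    (hG' : ∀ F ∈ insert G' D, Admissible F)
    (h : signedVec G + signedVec G' ∈ Submodule.span ℝ (signedVec '' D)) :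
    coneSupport (flagCone (insert G D)) = coneSupport (flagCone (insert G' D)) :=
  (coneSupport_flagCone_insert_subset hG hG' h).antisymm
    (coneSupport_flagCone_insert_subset hG' hG (add_comm (signedVec G) _ ▸ h))

lemma isBalanced_of_factorsThrough {c : conesOfDim (flagFan n d) d → ℤ}
    (hc : c.FactorsThrough fun σ => coneSupport σ.1) : IsBalanced (flagFan n d) d c := by
  rw [isBalanced_iff_flagWeight_eq]
  intro D G hG G' hG' h
  rw [flagWeight_eq hG.2.flagCone_mem, flagWeight_eq hG'.2.flagCone_mem]
  exact hc (coneSupport_flagCone_insert_eq hG.2.admissible hG'.2.admissible h)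

end Support

/-! ### Complete flags as words -/

/-- The letters of a word, as a subset of `J`. -/
def letters (w : List (Ground n)) : Set (Ground n) := {a | a ∈ w}

/-- The flag of the letter sets of the nonempty final segments of a word: reading from the right,
each letter is the element by which the next member of the flag grows. -/
def wordFlag : List (Ground n) → Set (Set (Ground n))
  | [] => ∅
  | a :: w => insert (letters (a :: w)) (wordFlag w)

/-- The words of length `d` whose letters have distinct indices; they describe the complete
flags. -/
structure IsSignedWord (d : ℕ) (w : List (Ground n)) : Prop where
  nodup : (w.map index).Nodup
  length_eq : w.length = d

section Words

variable {d : ℕ} {a b : Ground n} {p q u v w : List (Ground n)} {C : Set (Set (Ground n))}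

lemma letters_cons (a : Ground n) (w : List (Ground n)) :
    letters (a :: w) = insert a (letters w) := by
  ext b
  exact List.mem_cons

lemma letters_eq_of_perm (h : u.Perm v) : letters u = letters v :=
  Set.ext fun _ => h.mem_iff

lemma IsSignedWord.of_perm_map_index (hu : IsSignedWord d u)
    (h : (u.map index).Perm (v.map index)) : IsSignedWord d v where
  nodup := h.nodup_iff.1 hu.nodup
  length_eq := by
    rw [← hu.length_eq, ← List.length_map index, ← h.length_eq, List.length_map]

lemma IsSignedWord.notMem_letters (h : IsSignedWord d (a :: w)) : a ∉ letters w :=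
  fun ha => (List.nodup_cons.1 h.nodup).1 (List.mem_map_of_mem ha)

lemma IsSignedWord.of_append (h : IsSignedWord d (p ++ w)) : IsSignedWord w.length w where
  nodup := by
    have := h.nodup
    rw [List.map_append] at this
    exact this.of_append_right
  length_eq := rfl

lemma IsSignedWord.admissible_letters (h : IsSignedWord d w) : Admissible (letters w) :=
  admissible_iff_injOn.2 fun _ ha _ hb hab => List.inj_on_of_nodup_map h.nodup ha hb hab

lemma IsSignedWord.ncard_letters (h : IsSignedWord d w) : (letters w).ncard = d := by
  classical
  have hletters : letters w = w.toFinset := by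
    ext a
    simp [letters]
  rw [hletters, Set.ncard_coe_finset, List.toFinset_card_of_nodup h.nodup.of_map, h.length_eq]

lemma subset_letters_of_mem_wordFlag {F : Set (Ground n)} (hF : F ∈ wordFlag w) :
    F ⊆ letters w := by
  induction w with
  | nil => exact absurd hF (Set.notMem_empty F)
  | cons a w ih =>
    rcases hF with rfl | hF
    · exact subset_rfl
    · exact (ih hF).trans (letters_cons a w ▸ Set.subset_insert a _)

lemma letters_mem_insert_empty_wordFlag (w : List (Ground n)) :
    letters w ∈ insert ∅ (wordFlag w) := by
  cases w with
  | nil => exact Or.inl (Set.eq_empty_of_forall_notMem fun _ => List.not_mem_nil)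
  | cons a w => exact Or.inr (Set.mem_insert _ _)

lemma signedVec_letters_mem_span (w : List (Ground n)) :
    signedVec (letters w) ∈ Submodule.span ℝ (signedVec '' wordFlag w) := by
  rcases letters_mem_insert_empty_wordFlag w with h | h
  · exact h ▸ signedVec_empty (n := n) ▸ zero_mem _
  · exact Submodule.subset_span (Set.mem_image_of_mem _ h)

lemma IsCompleteFlag.insert_top {T : Set (Ground n)} (hC : IsCompleteFlag d C) (hT : Admissible T)
    (hcard : T.ncard = d + 1) (hsub : ∀ F ∈ C, F ⊆ T) : IsCompleteFlag (d + 1) (insert T C) := by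
  have hTC : T ∉ C := fun h => by have := hC.ncard_le T h; omega
  refine ⟨⟨?_, ?_, hC.isChain.insert fun F hF _ => Or.inr (hsub F hF)⟩, ?_, ?_⟩
  · exact Set.forall_mem_insert.2 ⟨hT, hC.admissible⟩
  · refine Set.forall_mem_insert.2 ⟨?_, hC.nonempty⟩
    exact (Set.ncard_pos (Set.toFinite T)).1 (hcard ▸ Nat.succ_pos d)
  · exact Set.forall_mem_insert.2 ⟨hcard.le, fun F hF => (hC.ncard_le F hF).trans (Nat.le_succ d)⟩
  · rw [Set.ncard_insert_of_notMem hTC, hC.ncard_eq]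

lemma IsSignedWord.isCompleteFlag (h : IsSignedWord d w) : IsCompleteFlag d (wordFlag w) := by
  induction w generalizing d with
  | nil =>
    obtain rfl : 0 = d := h.length_eq
    exact ⟨⟨by simp [wordFlag], by simp [wordFlag], by simp [wordFlag]⟩, by simp [wordFlag],
      Set.ncard_empty _⟩
  | cons a w ih =>
    obtain rfl : w.length + 1 = d := h.length_eq
    have hw : IsSignedWord w.length w := h.of_append (p := [a])
    refine (ih hw).insert_top h.admissible_letters h.ncard_letters fun F hF => ?_
    exact (subset_letters_of_mem_wordFlag hF).trans (letters_cons a w ▸ Set.subset_insert a _)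

lemma IsCompleteFlag.sdiff_singleton {T : Set (Ground n)} (hC : IsCompleteFlag (d + 1) C)
    (hT : T ∈ C) (hcard : T.ncard = d + 1) : IsCompleteFlag d (C \ {T}) where
  toIsFlag := hC.toIsFlag.mono Set.sdiff_subset
  ncard_le F hF := by
    have hle := hC.ncard_le F hF.1
    have hne : F.ncard ≠ d + 1 := fun h => hF.2 (hC.eq_of_ncard_eq hF.1 hT (h.trans hcard.symm))
    omega
  ncard_eq := by rw [Set.ncard_sdiff_singleton_of_mem hT, hC.ncard_eq, Nat.add_sub_cancel]

lemma IsCompleteFlag.exists_wordFlag_eq (hC : IsCompleteFlag d C) :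
    ∃ w, IsSignedWord d w ∧ wordFlag w = C := by
  induction d generalizing C with
  | zero =>
    exact ⟨[], ⟨List.nodup_nil, rfl⟩, ((Set.ncard_eq_zero (Set.toFinite C)).1 hC.ncard_eq).symm⟩
  | succ d ih =>
    obtain ⟨T, hTC, hT⟩ := hC.exists_ncard_eq (Nat.le_add_left 1 d) le_rfl
    obtain ⟨w, hw, hwC⟩ := ih (hC.sdiff_singleton hTC hT)
    have hsub : letters w ⊆ T := by
      rcases letters_mem_insert_empty_wordFlag w with h | h
      · exact h ▸ Set.empty_subset T
      · rw [hwC] at h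
        exact hC.subset_of_ncard_le h.1 hTC (hT ▸ hC.ncard_le _ h.1)
    obtain ⟨a, ha, rfl⟩ := (Set.exists_eq_insert_iff_ncard (Set.toFinite (letters w))).2
      ⟨hsub, by rw [hw.ncard_letters, hT]⟩
    refine ⟨a :: w, ⟨List.nodup_cons.2 ⟨?_, hw.nodup⟩, congrArg Nat.succ hw.length_eq⟩, ?_⟩
    · intro hmem
      obtain ⟨b, hb, hba⟩ := List.mem_map.1 hmem
      have hinj := admissible_iff_injOn.1 (hC.admissible _ hTC)
      exact ha (hinj (Set.mem_insert_of_mem a hb) (Set.mem_insert a _) hba ▸ hb)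
    · rw [wordFlag, hwC, letters_cons, Set.insert_sdiff_singleton, Set.insert_eq_of_mem hTC]

lemma IsSignedWord.coneSupport_flagCone_wordFlag (h : IsSignedWord d w) :
    coneSupport (flagCone (wordFlag w)) = (w.map index).toFinset := by
  ext i
  rw [mem_coneSupport_flagCone h.isCompleteFlag.admissible, List.mem_toFinset, List.mem_map]
  constructor
  · rintro ⟨F, hF, a, ha, rfl⟩
    exact ⟨a, subset_letters_of_mem_wordFlag hF ha, rfl⟩
  · rintro ⟨a, ha, rfl⟩
    rcases letters_mem_insert_empty_wordFlag w with h | h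
    · exact absurd (h ▸ ha : a ∈ (∅ : Set (Ground n))) (Set.notMem_empty a)
    · exact ⟨_, h, a, ha, rfl⟩

lemma exists_wordFlag_append (h : letters u = letters v) (p : List (Ground n)) :
    ∃ E, wordFlag (p ++ u) = E ∪ wordFlag u ∧ wordFlag (p ++ v) = E ∪ wordFlag v := by
  induction p with
  | nil => exact ⟨∅, by simp, by simp⟩
  | cons a p ih =>
    obtain ⟨E, hu, hv⟩ := ih
    have hletters : letters (a :: (p ++ u)) = letters (a :: (p ++ v)) := by
      ext b
      have hb : b ∈ u ↔ b ∈ v := Set.ext_iff.1 h b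
      simp [letters, hb]
    refine ⟨insert (letters (a :: (p ++ u))) E, ?_, ?_⟩
    · rw [List.cons_append, wordFlag, hu, Set.insert_union]
    · rw [List.cons_append, wordFlag, hv, Set.insert_union, hletters]

end Words

/-! ### Balanced weights depend on the support only -/

section Invariance

variable {d : ℕ} {a b : Ground n} {p q u v w : List (Ground n)}
  {c : conesOfDim (flagFan n d) d → ℤ}

lemma flagWeight_insert_eq (hc : IsBalanced (flagFan n d) d c) {D : Set (Set (Ground n))}
    {G G' : Set (Ground n)} (hG : IsCompleteFlag d (insert G D))
    (hG' : IsCompleteFlag d (insert G' D)) (hcard : G.ncard = G'.ncard)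
    (h : signedVec G + signedVec G' ∈ Submodule.span ℝ (signedVec '' D)) :
    flagWeight c (insert G D) = flagWeight c (insert G' D) := by
  rcases eq_or_ne G G' with rfl | hne
  · rfl
  · have hGD : G ∉ D := fun hmem =>
      hne (hG'.eq_of_ncard_eq (Set.mem_insert_of_mem G' hmem) (Set.mem_insert G' D) hcard)
    have hG'D : G' ∉ D := fun hmem =>
      hne (hG.eq_of_ncard_eq (Set.mem_insert G D) (Set.mem_insert_of_mem G hmem) hcard)
    exact isBalanced_iff_flagWeight_eq.1 hc D G ⟨hGD, hG⟩ G' ⟨hG'D, hG'⟩ h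

lemma flagWeight_wordFlag_star_cons (hc : IsBalanced (flagFan n d) d c)
    (hw : IsSignedWord d (a :: q)) :
    flagWeight c (wordFlag (star a :: q)) = flagWeight c (wordFlag (a :: q)) := by
  have hs : IsSignedWord d (star a :: q) := hw.of_perm_map_index (by simp)
  refine flagWeight_insert_eq hc hs.isCompleteFlag hw.isCompleteFlag
    (hs.ncard_letters.trans hw.ncard_letters.symm) ?_
  have hsum : signedVec (letters (star a :: q)) + signedVec (letters (a :: q)) =
      signedVec (letters q) + signedVec (letters q) := by
    rw [letters_cons, letters_cons, signedVec_insert hs.notMem_letters,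
      signedVec_insert hw.notMem_letters, signedUnit_star]
    abel
  exact hsum ▸ add_mem (signedVec_letters_mem_span q) (signedVec_letters_mem_span q)

lemma flagWeight_wordFlag_swap (hc : IsBalanced (flagFan n d) d c)
    (hw : IsSignedWord d (p ++ a :: b :: q)) :
    flagWeight c (wordFlag (p ++ a :: b :: q)) = flagWeight c (wordFlag (p ++ b :: a :: q)) := by
  have hperm : (a :: b :: q).Perm (b :: a :: q) := List.Perm.swap b a q
  have hw' : IsSignedWord d (p ++ b :: a :: q) :=
    hw.of_perm_map_index ((hperm.append_left p).map index)
  obtain ⟨E, hE, hE'⟩ := exists_wordFlag_append (letters_eq_of_perm hperm) p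
  set T := letters (a :: b :: q) with hT
  have hD : wordFlag (p ++ a :: b :: q) =
      insert (letters (b :: q)) (E ∪ insert T (wordFlag q)) := by
    rw [hE, wordFlag, wordFlag, Set.insert_comm, Set.union_insert]
  have hD' : wordFlag (p ++ b :: a :: q) =
      insert (letters (a :: q)) (E ∪ insert T (wordFlag q)) := by
    rw [hE', wordFlag, wordFlag, Set.insert_comm, Set.union_insert, hT, letters_eq_of_perm hperm]
  have hbq : IsSignedWord (q.length + 1) (b :: q) :=
    IsSignedWord.of_append (p := p ++ [a]) (w := b :: q) (by simpa using hw)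
  have haq : IsSignedWord (q.length + 1) (a :: q) :=
    IsSignedWord.of_append (p := p ++ [b]) (w := a :: q) (by simpa using hw')
  have hsum : signedVec (letters (b :: q)) + signedVec (letters (a :: q)) =
      signedVec T + signedVec (letters q) := by
    rw [hT, letters_cons a q, letters_cons a (b :: q), signedVec_insert haq.notMem_letters,
      signedVec_insert hw.of_append.notMem_letters]
    abel
  rw [hD, hD']
  refine flagWeight_insert_eq hc (hD ▸ hw.isCompleteFlag) (hD' ▸ hw'.isCompleteFlag)
    (hbq.ncard_letters.trans haq.ncard_letters.symm) (hsum ▸ add_mem ?_ ?_)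
  · exact Submodule.subset_span (Set.mem_image_of_mem _ (Or.inr (Set.mem_insert T _)))
  · refine Submodule.span_mono (Set.image_mono ?_) (signedVec_letters_mem_span q)
    exact (Set.subset_insert T _).trans Set.subset_union_right

lemma flagWeight_wordFlag_append_eq_of_perm (hc : IsBalanced (flagFan n d) d c) (h : u.Perm v)
    (p : List (Ground n)) (hw : IsSignedWord d (p ++ u)) :
    flagWeight c (wordFlag (p ++ u)) = flagWeight c (wordFlag (p ++ v)) := by
  induction h generalizing p with
  | nil => rfl
  | cons a _ ih => simpa using ih (p ++ [a]) (by simpa using hw)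
  | swap a b q => exact flagWeight_wordFlag_swap hc hw
  | trans huv _ ih₁ ih₂ =>
    exact (ih₁ p hw).trans
      (ih₂ p (hw.of_perm_map_index ((huv.append_left p).map index)))

lemma flagWeight_wordFlag_eq_of_perm (hc : IsBalanced (flagFan n d) d c) (h : u.Perm v)
    (hu : IsSignedWord d u) : flagWeight c (wordFlag u) = flagWeight c (wordFlag v) :=
  flagWeight_wordFlag_append_eq_of_perm hc h [] hu

lemma flagWeight_wordFlag_append_map_inl (hc : IsBalanced (flagFan n d) d c)
    (p w : List (Ground n)) (hw : IsSignedWord d (p ++ w)) :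
    flagWeight c (wordFlag (p ++ w)) =
      flagWeight c (wordFlag (p ++ (w.map index).map Sum.inl)) := by
  induction w generalizing p with
  | nil => rfl
  | cons a q ih =>
    have hperm (x : Ground n) : (p ++ x :: q).Perm (x :: (p ++ q)) := List.perm_middle
    have hpaq : IsSignedWord d (a :: (p ++ q)) := hw.of_perm_map_index ((hperm a).map index)
    have hpiq : IsSignedWord d (p ++ Sum.inl (index a) :: q) := hw.of_perm_map_index (by simp)
    have hunsign : flagWeight c (wordFlag (a :: (p ++ q))) =
        flagWeight c (wordFlag (Sum.inl (index a) :: (p ++ q))) := by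
      cases a with
      | inl i => rfl
      | inr i => exact (flagWeight_wordFlag_star_cons hc hpaq).symm
    rw [flagWeight_wordFlag_eq_of_perm hc (hperm a) hw, hunsign,
      ← flagWeight_wordFlag_eq_of_perm hc (hperm _) hpiq, List.map_cons, List.map_cons,
      List.append_cons, List.append_cons p _ (List.map _ _)]
    exact ih _ (List.append_cons p _ q ▸ hpiq)

lemma flagWeight_wordFlag_eq (hc : IsBalanced (flagFan n d) d c) (hu : IsSignedWord d u)
    (hv : IsSignedWord d v) (h : (u.map index).Perm (v.map index)) :
    flagWeight c (wordFlag u) = flagWeight c (wordFlag v) := by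
  have hu' : IsSignedWord d ((u.map index).map Sum.inl) :=
    hu.of_perm_map_index (by simp [Function.comp_def])
  calc flagWeight c (wordFlag u) = flagWeight c (wordFlag ((u.map index).map Sum.inl)) :=
        flagWeight_wordFlag_append_map_inl hc [] u hu
    _ = flagWeight c (wordFlag ((v.map index).map Sum.inl)) :=
        flagWeight_wordFlag_eq_of_perm hc (h.map Sum.inl) hu'
    _ = flagWeight c (wordFlag v) := (flagWeight_wordFlag_append_map_inl hc [] v hv).symm

theorem isBalanced_iff_factorsThrough :
    IsBalanced (flagFan n d) d c ↔ c.FactorsThrough fun σ => coneSupport σ.1 := by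
  refine ⟨fun hc => ?_, isBalanced_of_factorsThrough⟩
  rintro ⟨σ, hσ⟩ ⟨σ', hσ'⟩ hsupp
  obtain ⟨C, hC, rfl⟩ := mem_conesOfDim_flagFan_iff.1 hσ
  obtain ⟨C', hC', rfl⟩ := mem_conesOfDim_flagFan_iff.1 hσ'
  obtain ⟨u, hu, rfl⟩ := hC.exists_wordFlag_eq
  obtain ⟨v, hv, rfl⟩ := hC'.exists_wordFlag_eq
  simp only [hu.coneSupport_flagCone_wordFlag, hv.coneSupport_flagCone_wordFlag] at hsupp
  rw [← flagWeight_eq (c := c) hσ, ← flagWeight_eq (c := c) hσ']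
  exact flagWeight_wordFlag_eq hc hu hv
    (List.perm_of_nodup_nodup_toFinset_eq hu.nodup hv.nodup hsupp)

end Invariance

/-! ### The group of Minkowski weights -/

lemma nonempty_addEquiv_of_mem_iff_factorsThrough {X Y A : Type*} [AddCommGroup A] {π : X → Y}
    (hπ : Function.Surjective π) (H : AddSubgroup (X → A))
    (hH : ∀ c, c ∈ H ↔ c.FactorsThrough π) : Nonempty (H ≃+ (Y → A)) := by
  let pullback : (Y → A) →+ H :=
    { toFun := fun g => ⟨g ∘ π, (hH _).2 fun _ _ h => congrArg g h⟩
      map_zero' := rfl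
      map_add' := fun _ _ => rfl }
  have hinj : Function.Injective pullback := fun _ _ h =>
    hπ.injective_comp_right (congrArg Subtype.val h)
  have hsurj : Function.Surjective pullback := fun c => by
    obtain ⟨g, hg⟩ := (Function.factorsThrough_iff c.1).1 ((hH c).1 c.2)
    exact ⟨g, Subtype.ext hg.symm⟩
  exact ⟨(AddEquiv.ofBijective pullback ⟨hinj, hsurj⟩).symm⟩

section MinkowskiWeights

variable {d k : ℕ}

lemma card_coneSupport {σ : PointedCone ℝ (Fin n → ℝ)} (hσ : σ ∈ conesOfDim (flagFan n d) d) :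
    (coneSupport σ).card = d := by
  obtain ⟨C, hC, rfl⟩ := mem_conesOfDim_flagFan_iff.1 hσ
  obtain ⟨w, hw, rfl⟩ := hC.exists_wordFlag_eq
  rw [hw.coneSupport_flagCone_wordFlag, List.toFinset_card_of_nodup hw.nodup, List.length_map,
    hw.length_eq]

lemma exists_coneSupport_eq (s : Finset (Fin n)) :
    ∃ σ ∈ conesOfDim (flagFan n s.card) s.card, coneSupport σ = s := by
  have hw : IsSignedWord s.card (s.toList.map (Sum.inl : Fin n → Ground n)) :=
    ⟨by simpa [Function.comp_def] using s.nodup_toList, by simp⟩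
  refine ⟨_, hw.isCompleteFlag.flagCone_mem, ?_⟩
  rw [hw.coneSupport_flagCone_wordFlag]
  simp [Function.comp_def]

lemma nonempty_minkowskiWeights_addEquiv {Δ : Set (PointedCone ℝ (Fin n → ℝ))} [Finite Δ]
    (hΔ : Δ = flagFan n d) : Nonempty (minkowskiWeights Δ d ≃+ (Fin (n.choose d) → ℤ)) := by
  subst hΔ
  have hsurj : Function.Surjective fun σ : conesOfDim (flagFan n d) d =>
      (⟨coneSupport σ.1, card_coneSupport σ.2⟩ : Set.powersetCard (Fin n) d) := by
    rintro ⟨s, rfl⟩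
    obtain ⟨σ, hσ, hs⟩ := exists_coneSupport_eq s
    exact ⟨⟨σ, hσ⟩, Subtype.ext hs⟩
  obtain ⟨e⟩ := nonempty_addEquiv_of_mem_iff_factorsThrough hsurj
    (minkowskiWeights (flagFan n d) d) fun c =>
      isBalanced_iff_factorsThrough.trans (by simp only [Function.FactorsThrough, Subtype.ext_iff])
  have hcard : Nat.card (Set.powersetCard (Fin n) d) = n.choose d := by
    rw [Set.powersetCard.card, Nat.card_fin]
  exact ⟨e.trans
    (LinearEquiv.funCongrLeft ℤ ℤ (Finite.equivFinOfCardEq hcard).symm).toAddEquiv⟩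

lemma mem_latticeOfFlats_uniformEnvelope_iff (hk : 1 ≤ k) (hn : 1 ≤ n) {F : Set (Ground n)} :
    F ∈ latticeOfFlats (uniformEnvelope k n) \ {∅, Set.univ} ↔
      Admissible F ∧ F.Nonempty ∧ F.ncard ≤ k - 1 := by
  have hflat : F ∈ latticeOfFlats (uniformEnvelope k n) ↔
      (Admissible F ∧ F.ncard < k) ∨ F = Set.univ :=
    or_congr (isFlat_uniformEnvelope_and_admissible_iff hn) Iff.rfl
  have huniv : Admissible F → F ≠ Set.univ := fun h heq => not_admissible_univ hn (heq ▸ h)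
  rw [Set.mem_sdiff, hflat, Set.mem_insert_iff, Set.mem_singleton_iff, not_or,
    ← ne_eq F ∅, ← Set.nonempty_iff_ne_empty, Nat.le_sub_one_iff_lt hk]
  tauto

lemma bergmanFan_uniformEnvelope (hk : 1 ≤ k) (hn : 1 ≤ n) :
    bergmanFan (uniformEnvelope k n) = flagFan n (k - 1) := by
  ext σ
  constructor
  · rintro ⟨C, hC, hchain, rfl⟩
    have hC' := fun F (hF : F ∈ C) => (mem_latticeOfFlats_uniformEnvelope_iff hk hn).1 (hC hF)
    exact ⟨C, ⟨fun F hF => (hC' F hF).1, fun F hF => (hC' F hF).2.1, hchain⟩,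
      fun F hF => (hC' F hF).2.2, rfl⟩
  · rintro ⟨C, hC, hle, rfl⟩
    exact ⟨C, fun F hF => (mem_latticeOfFlats_uniformEnvelope_iff hk hn).2
      ⟨hC.admissible F hF, hC.nonempty F hF, hle F hF⟩, hC.isChain, rfl⟩

lemma isEmpty_addEquiv_int {A : Type*} [AddCommGroup A] {m : ℕ} (hm : m ≠ 1)
    (e : A ≃+ (Fin m → ℤ)) : IsEmpty (A ≃+ ℤ) := by
  refine ⟨fun e' => hm ?_⟩
  simpa using (e.symm.trans e').toIntLinearEquiv.finrank_eq

lemma choose_pred_ne_one (hk : 2 ≤ k) (hkn : k ≤ n) : n.choose (k - 1) ≠ 1 := by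
  rw [Ne, Nat.choose_eq_one_iff]
  omega

end MinkowskiWeights

end SympMatroid

theorem lemma5p14 (n k : ℕ) (hk : 1 ≤ k) (hkn : k ≤ n) :
    (∃! M : Matroid (SympMatroid.Ground n),
      SympMatroid.IsEnvelopingMatroid (SympMatroid.uniform k n) M) ∧
    ∀ M : Matroid (SympMatroid.Ground n),
      SympMatroid.IsEnvelopingMatroid (SympMatroid.uniform k n) M →
      Nonempty (SympMatroid.minkowskiWeights (SympMatroid.bergmanFan M) (k - 1) ≃+
        (Fin (n.choose (k - 1)) → ℤ)) ∧
      (2 ≤ k →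
        IsEmpty (SympMatroid.minkowskiWeights (SympMatroid.bergmanFan M) (k - 1) ≃+ ℤ)) := by
  have henv := SympMatroid.isEnvelopingMatroid_uniformEnvelope hk hkn
  refine ⟨⟨_, henv, fun M hM => hM.unique henv⟩, fun M hM => ?_⟩
  obtain rfl := hM.unique henv
  obtain ⟨e⟩ := SympMatroid.nonempty_minkowskiWeights_addEquiv
    (SympMatroid.bergmanFan_uniformEnvelope hk (hk.trans hkn))
  have hne (hk2 : 2 ≤ k) := SympMatroid.choose_pred_ne_one hk2 hkn
  exact ⟨⟨e⟩, fun hk2 => SympMatroid.isEmpty_addEquiv_int (hne hk2) e⟩
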